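/- Let $X_1,\dots,X_n\in\mathbb R^p$ ($n\ge1$), $y_1,\dots,y_n\in\{+1,-1\}$ and $c>0$. Write $k_i(\theta)=\log(1+\exp(-y_i\theta^\top X_i))$, $k(\theta)=\frac1n\sum_{i=1}^n k_i(\theta)$ and $f(\theta)=\frac12\,(c+k(\theta))^2$. Let $\widehat\theta$ be a minimizer of $k$ over $\mathbb R^p$, and assume that the empirical risk is non-degenerate, i.e. that $\nabla^2k(\widehat\theta)$ is positive definite. Consider SGD with fixed step size $\eta>0$, $\theta_{j+1}=\theta_j-\eta\,g_s(\theta_j)$ for $j\ge1$, with stochastic gradient $g_s=\Psi_s\Upsilon_s$, where at every step $$\Psi_s(\theta)=c+\frac1{S_\Psi}\sum_{i\in I^\Psi}k_i(\theta),\qquad \Upsilon_s(\theta)=\frac1{S_\Upsilon}\sum_{i\in I^\Upsilon}\nabla k_i(\theta).$$ Here $I^\Upsilon$ consists of $S_\Upsilon\ge1$ indices drawn uniformly from $\{1,\dots,n\}$ with replacement, and $I^\Psi$ consists of $S_\Psi\ge1$ indices drawn uniformly either with replacement, or without replacement (then $S_\Psi\le n$). The start $\theta_1$ (which may be random) and all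 the batches $I^\Psi,I^\Upsilon$ of all the steps are mutually independent. Let $\bar\theta_t=\frac1t\sum_{j=1}^t\theta_j$ and $$H=\nabla^2f(\widehat\theta),\qquad G=\frac1{S_\Upsilon}\,K_G(\widehat\theta)\,\frac1n\sum_{i=1}^n\nabla k_i(\widehat\theta)\nabla k_i(\widehat\theta)^\top ,$$ where $K_G$ is defined by * with replacement: $K_G(\theta)=\frac1{S_\Psi}\Big(\frac1n\sum_{i=1}^n(c+k_i(\theta))^2\Big)+\frac{S_\Psi-1}{S_\Psi}(c+k(\theta))^2$; * without replacement: $K_G(\theta)=\frac{1-\frac{S_\Psi-1}{n-1}}{S_\Psi}\Big(\frac1n\sum_{i=1}^n(c+k_i(\theta))^2\Big)+\frac{S_\Psi-1}{S_\Psi}\,\frac n{n-1}\,(c+k(\theta))^2$ (for $n=1$, when $S_\Psi=1$, the terms with factor $S_\Psi-1$ are read as $0$). Then: 1. $H=(c+k(\widehat\theta))\,\nabla^2k(\widehat\theta)$. 2. $K_G(\theta)=\mathbb E[\Psi_s(\theta)^2]$ for every $\theta\in\mathbb R^p$, in both sampling schemes. 3. For every bound $S_{\max}$ on the batch sizes there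 is $\eta_0>0$ such that for all constants $K,M$ there is a constant $C>0$ with the following property. For both sampling schemes, all batch sizes $S_\Psi,S_\Upsilon\le S_{\max}$, all $0<\eta\le\eta_0$, all starts with $\|\theta_1-\widehat\theta\|_2^2\le K\eta$ almost surely, and all $t\ge1$ with $t\eta^2\le M$, the average $\bar\theta_t$ is square integrable and $$\Big\|\,t\,\mathbb E\big[(\bar\theta_t-\widehat\theta)(\bar\theta_t-\widehat\theta)^\top\big]-H^{-1}GH^{-1}\Big\|_2\le C\Big(\sqrt\eta+\sqrt{\tfrac1{t\eta}+t\eta^2}\Big),$$ where $\|\cdot\|_2$ is the spectral norm. Here $\eta_0$ depends only on the data $(X_i,y_i)_{i\le n}$, $c$ and $S_{\max}$, and $C$ only on these and on $K$ and $M$. -/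

import Mathlib

open MeasureTheory ProbabilityTheory

noncomputable section

namespace LogisticSGD

/-- Hessian matrix of `F` at `θ`: the Jacobian matrix of the gradient field. -/
def hessian {p : ℕ} (F : EuclideanSpace ℝ (Fin p) → ℝ) (θ : EuclideanSpace ℝ (Fin p)) :
    Matrix (Fin p) (Fin p) ℝ :=
  Matrix.of fun i j => fderiv ℝ (gradient F) θ (EuclideanSpace.single j 1) i

/-- The outer product `u vᵀ`. -/
def outer {p : ℕ} (u v : EuclideanSpace ℝ (Fin p)) : Matrix (Fin p) (Fin p) ℝ :=
  Matrix.of fun i j => u i * v j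

/-- The spectral norm `‖A‖₂`: the operator norm with respect to the Euclidean norm. -/
def specNorm {p : ℕ} (A : Matrix (Fin p) (Fin p) ℝ) : ℝ :=
  ‖Matrix.toEuclideanCLM (n := Fin p) (𝕜 := ℝ) A‖

/-! ### The logistic risk and the modified objective -/

/-- `kᵢ(θ) = log (1 + exp (-yᵢ θᵀXᵢ))`. -/
def loss {n p : ℕ} (X : Fin n → EuclideanSpace ℝ (Fin p)) (y : Fin n → ℝ) (i : Fin n)
    (θ : EuclideanSpace ℝ (Fin p)) : ℝ :=
  Real.log (1 + Real.exp (-(y i * inner ℝ θ (X i))))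

/-- The empirical logistic risk `k(θ) = (1/n) ∑ᵢ kᵢ(θ)`. -/
def risk {n p : ℕ} (X : Fin n → EuclideanSpace ℝ (Fin p)) (y : Fin n → ℝ)
    (θ : EuclideanSpace ℝ (Fin p)) : ℝ :=
  (1 / (n : ℝ)) * ∑ i, loss X y i θ

/-- The modified objective `f(θ) = ½ (c + k(θ))²`. -/
def objective {n p : ℕ} (X : Fin n → EuclideanSpace ℝ (Fin p)) (y : Fin n → ℝ) (c : ℝ)
    (θ : EuclideanSpace ℝ (Fin p)) : ℝ :=
  (1 / 2) * (c + risk X y θ) ^ 2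

/-! ### Stochastic gradients -/

/-- How the indices of the mini-batch for `Ψ_s` are drawn. -/
inductive Scheme where
  | withReplacement
  | withoutReplacement

/-- The possible outcomes of `S` successive draws from `n` indices. -/
def Scheme.draws : Scheme → (n S : ℕ) → Set (Fin S → Fin n)
  | .withReplacement, _, _ => Set.univ
  | .withoutReplacement, _, _ => {v | Function.Injective v}

/-- A batch size is admissible if it is positive and, when sampling without replacement,
at most the number of samples. -/
def Scheme.Admissible : Scheme → (n S : ℕ) → Prop
  | .withReplacement, _, S => 1 ≤ S
  | .withoutReplacement, n, S => 1 ≤ S ∧ S ≤ n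

/-- The estimate `Ψ_s(θ)` of `c + k(θ)` computed from the batch `v`. -/
def psiBatch {n p S : ℕ} (X : Fin n → EuclideanSpace ℝ (Fin p)) (y : Fin n → ℝ) (c : ℝ)
    (v : Fin S → Fin n) (θ : EuclideanSpace ℝ (Fin p)) : ℝ :=
  c + (1 / (S : ℝ)) * ∑ l, loss X y (v l) θ

/-- The estimate `Υ_s(θ)` of `∇k(θ)` computed from the batch `v`. -/
def upsBatch {n p S : ℕ} (X : Fin n → EuclideanSpace ℝ (Fin p)) (y : Fin n → ℝ)
    (v : Fin S → Fin n) (θ : EuclideanSpace ℝ (Fin p)) : EuclideanSpace ℝ (Fin p) :=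
  (1 / (S : ℝ)) • ∑ l, gradient (loss X y (v l)) θ

/-- The stochastic gradient `g_s(θ) = Ψ_s(θ) Υ_s(θ)`. -/
def stochGrad {n p SΨ SΥ : ℕ} (X : Fin n → EuclideanSpace ℝ (Fin p)) (y : Fin n → ℝ) (c : ℝ)
    (v : Fin SΨ → Fin n) (w : Fin SΥ → Fin n) (θ : EuclideanSpace ℝ (Fin p)) :
    EuclideanSpace ℝ (Fin p) :=
  psiBatch X y c v θ • upsBatch X y w θ

/-- SGD with fixed step size `η`, started at `θ₁`, for given sequences of batches.
`sgdIterate … m` is the iterate `θ_{m+1}`; in particular `sgdIterate … 0 = θ₁`. -/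
def sgdIterate {n p SΨ SΥ : ℕ} (X : Fin n → EuclideanSpace ℝ (Fin p)) (y : Fin n → ℝ) (c η : ℝ)
    (θ₁ : EuclideanSpace ℝ (Fin p)) (v : ℕ → Fin SΨ → Fin n) (w : ℕ → Fin SΥ → Fin n) :
    ℕ → EuclideanSpace ℝ (Fin p)
  | 0 => θ₁
  | m + 1 =>
      sgdIterate X y c η θ₁ v w m -
        η • stochGrad X y c (v m) (w m) (sgdIterate X y c η θ₁ v w m)

/-- The average `θ̄_t = (1/t) ∑_{j=1}^t θ_j` of the first `t` iterates. -/
def sgdAverage {n p SΨ SΥ : ℕ} (X : Fin n → EuclideanSpace ℝ (Fin p)) (y : Fin n → ℝ) (c η : ℝ)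
    (θ₁ : EuclideanSpace ℝ (Fin p)) (v : ℕ → Fin SΨ → Fin n) (w : ℕ → Fin SΥ → Fin n) (t : ℕ) :
    EuclideanSpace ℝ (Fin p) :=
  (1 / (t : ℝ)) • ∑ m ∈ Finset.range t, sgdIterate X y c η θ₁ v w m

/-- The random input of an SGD run: a start `θ₁` and batches `v m`, `w m` (for `Ψ_s`, `Υ_s`) such
that every `v m` is uniformly distributed according to the scheme, every `w m` consists of `SΥ`
uniform draws with replacement, and `θ₁, v 0, w 0, v 1, w 1, …` are mutually independent. -/
structure IsSampling {Ω : Type*} [MeasurableSpace Ω] (P : Measure Ω) {n p SΨ SΥ : ℕ}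
    (scheme : Scheme) (θ₁ : Ω → EuclideanSpace ℝ (Fin p))
    (v : ℕ → Ω → Fin SΨ → Fin n) (w : ℕ → Ω → Fin SΥ → Fin n) : Prop where
  measurable_start : Measurable θ₁
  measurable_psi : ∀ m, Measurable (v m)
  measurable_ups : ∀ m, Measurable (w m)
  law_psi : ∀ m, P.map (v m) = uniformOn (scheme.draws n SΨ)
  law_ups : ∀ m, P.map (w m) = uniformOn (Scheme.withReplacement.draws n SΥ)
  indep_batches : ∀ m, IndepFun (v m) (w m) P
  indep_steps : iIndepFun (fun m ω => (v m ω, w m ω)) P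
  indep_start : IndepFun θ₁ (fun ω m => (v m ω, w m ω)) P

/-! ### The limiting covariance -/

/-- The factor `K_G(θ)` for batches of size `S`. -/
def KG {n p : ℕ} (X : Fin n → EuclideanSpace ℝ (Fin p)) (y : Fin n → ℝ) (c : ℝ) (S : ℕ)
    (θ : EuclideanSpace ℝ (Fin p)) : Scheme → ℝ
  | .withReplacement =>
      (1 / (S : ℝ)) * ((1 / (n : ℝ)) * ∑ i, (c + loss X y i θ) ^ 2) +
        (((S : ℝ) - 1) / S) * (c + risk X y θ) ^ 2
  | .withoutReplacement =>
      ((1 - ((S : ℝ) - 1) / ((n : ℝ) - 1)) / S) * ((1 / (n : ℝ)) * ∑ i, (c + loss X y i θ) ^ 2) +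
        (((S : ℝ) - 1) / S) * ((n : ℝ) / ((n : ℝ) - 1)) * (c + risk X y θ) ^ 2

/-- `G = (1/S_Υ) K_G(θ) (1/n) ∑ᵢ ∇kᵢ(θ) ∇kᵢ(θ)ᵀ`, to be taken at the minimizer. -/
def GMat {n p : ℕ} (X : Fin n → EuclideanSpace ℝ (Fin p)) (y : Fin n → ℝ) (c : ℝ) (scheme : Scheme)
    (SΨ SΥ : ℕ) (θ : EuclideanSpace ℝ (Fin p)) : Matrix (Fin p) (Fin p) ℝ :=
  (1 / (SΥ : ℝ)) • KG X y c SΨ θ scheme •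
    (1 / (n : ℝ)) • ∑ i, outer (gradient (loss X y i) θ) (gradient (loss X y i) θ)

/-- The second moment matrix `𝔼[(Z - θ) (Z - θ)ᵀ]` of a random vector `Z` about `θ`. -/
def secondMoment {Ω : Type*} [MeasurableSpace Ω] (P : Measure Ω) {p : ℕ}
    (Z : Ω → EuclideanSpace ℝ (Fin p)) (θ : EuclideanSpace ℝ (Fin p)) :
    Matrix (Fin p) (Fin p) ℝ :=
  Matrix.of fun i j => ∫ ω, outer (Z ω - θ) (Z ω - θ) i j ∂P

end LogisticSGD

end

open LogisticSGD

/-!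
The proof views stochastic gradient descent, recentred at the minimizer, as a chain
`x (m + 1) = x m - η g (Z m) (x m)` driven by independent batches `Z m`, and splits the random
field into its mean `∇f` and a centred noise.

*Stability.* The stochastic gradient is Lipschitz at the minimizer with constants uniform in the
batches. Although the logistic gradient is bounded, the drift satisfies
`μ ‖x‖² ≤ ⟪x, ∇f(θ + x)⟫` for all `x` (`exists_drift`): a nondegenerate convex risk grows linearly,
and in `∇f = (c + k) ∇k` the factor `c + k` turns this into linear growth of the drift. Hence for
small `η` the second and fourth moments contract up to noise, and `E‖x m‖² = O(η)` and
`E‖x m‖⁴ = O(η²)` hold uniformly in `m` (`IsChain.moments_le`).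

*Decomposition.* Linearising the drift at the minimizer and summing the recursion gives the exact
identity `H ∑ x m = Y - S` (`IsChain.map_sum_eq`). Here `S` is the accumulated noise, and `Y`
consists of the telescoped displacement divided by `η` and of the linearisation errors, which are
quadratic in `x m`. The moment bounds yield `E‖Y‖² = O(t (1 / (t η) + t η²))`.

*Covariance.* The increments of `S` are orthogonal with respect to every bilinear form, since the
state is independent of the next batch; so the covariance of `S` is a sum of noise covariances along
the chain, each within `O(√η)` of the one at the minimizer. That one is `G`, by the moment formulas
for the mini-batches (`inner_toEuclideanCLM_GMat`). The cross terms of `Y` and `S` are split by the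
weighted inequality of arithmetic and geometric means (`IsChain.abs_integral_bilin_sub_le`); for
`t η < 1` the error bound exceeds a constant and nothing has to cancel. Conjugation by `H⁻¹` gives
the spectral norm estimate (`specNorm_smul_secondMoment_sub_le`).
-/

namespace LogisticSGD

/-! ### Independence along a recursion -/

/-- Associativity of independence: a variable that is independent of a pair of independent
variables can be grouped with the first of them. -/
lemma IndepFun.prodMk_of_indepFun_prodMk {Ω α β γ : Type*} [MeasurableSpace Ω]
    [MeasurableSpace α] [MeasurableSpace β] [MeasurableSpace γ] {P : Measure Ω}
    [IsProbabilityMeasure P] {U : Ω → α} {V : Ω → β} {W : Ω → γ}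
    (hU : Measurable U) (hV : Measurable V) (hW : Measurable W)
    (h : IndepFun U (fun ω => (V ω, W ω)) P) (hVW : IndepFun V W P) :
    IndepFun (fun ω => (U ω, V ω)) W P := by
  have hUV : IndepFun U V P := h.comp measurable_id measurable_fst
  rw [indepFun_iff_map_prod_eq_prod_map_map (by fun_prop) (by fun_prop)] at h hVW hUV ⊢
  have := Measure.isProbabilityMeasure_map (μ := P) hU.aemeasurable
  have := Measure.isProbabilityMeasure_map (μ := P) hV.aemeasurable
  have := Measure.isProbabilityMeasure_map (μ := P) hW.aemeasurable
  rw [hUV, ← MeasurableEquiv.prodAssoc.map_measurableEquiv_injective.eq_iff,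
    Measure.prodAssoc_prod, ← hVW, ← h, Measure.map_map (by fun_prop) (by fun_prop)]
  rfl

/-- A term of an independent sequence is independent of the whole sequence of later terms. -/
lemma iIndepFun.indepFun_tail {Ω F : Type*} [MeasurableSpace Ω] [MeasurableSpace F]
    {P : Measure Ω} [IsProbabilityMeasure P] {Z : ℕ → Ω → F} (hZ : ∀ m, Measurable (Z m))
    (hind : iIndepFun Z P) (m : ℕ) :
    IndepFun (Z m) (fun ω k => Z (m + 1 + k) ω) P := by
  refine IndepFun.indepFun_process (Y := fun k => Z (m + 1 + k)) (hZ m)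
    (fun k => hZ (m + 1 + k)) fun I => ?_
  have hdisj : Disjoint ({m} : Finset ℕ) (I.image (fun k => m + 1 + k)) := by
    simp only [Finset.disjoint_singleton_left, Finset.mem_image, not_exists, not_and]
    intro k _ hk
    omega
  have h := hind.indepFun_finset {m} (I.image (fun k => m + 1 + k)) hdisj hZ
  have hφ : Measurable fun u : ({m} : Finset ℕ) → F => u ⟨m, Finset.mem_singleton_self m⟩ :=
    measurable_pi_apply _
  have hψ : Measurable fun (u : I.image (fun k => m + 1 + k) → F) (k : I) =>
      u ⟨m + 1 + k, Finset.mem_image_of_mem _ k.2⟩ :=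
    measurable_pi_lambda _ fun _ => measurable_pi_apply _
  exact h.comp hφ hψ

/-- If `s (m + 1)` is computed from `s m` and the fresh innovation `Z m`, then every state `s m` is
independent of `Z m`. The induction carries the stronger statement that `s m` is independent of all
of `Z m, Z (m + 1), …`. -/
lemma indepFun_state {Ω F T : Type*} [MeasurableSpace Ω] [MeasurableSpace F] [MeasurableSpace T]
    {P : Measure Ω} [IsProbabilityMeasure P] {Z : ℕ → Ω → F} (hZ : ∀ m, Measurable (Z m))
    (hind : iIndepFun Z P) {s : ℕ → Ω → T} (hs0 : Measurable (s 0))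
    (hs0ind : IndepFun (s 0) (fun ω m => Z m ω) P) {Φ : T × F → T} (hΦ : Measurable Φ)
    (hstep : ∀ m ω, s (m + 1) ω = Φ (s m ω, Z m ω)) (m : ℕ) :
    Measurable (s m) ∧ IndepFun (s m) (Z m) P := by
  suffices h : Measurable (s m) ∧ IndepFun (s m) (fun ω k => Z (m + k) ω) P from
    ⟨h.1, h.2.comp (φ := id) (ψ := fun u : ℕ → F => u 0) measurable_id (measurable_pi_apply 0)⟩
  induction m with
  | zero => simpa using ⟨hs0, hs0ind⟩
  | succ m ih =>
    obtain ⟨hm, him⟩ := ih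
    have hst : s (m + 1) = Φ ∘ fun ω => (s m ω, Z m ω) := funext (hstep m)
    refine ⟨hst ▸ hΦ.comp (hm.prodMk (hZ m)), ?_⟩
    have h1 : IndepFun (s m) (fun ω => (Z m ω, fun k => Z (m + 1 + k) ω)) P := by
      have h2 := him.comp (φ := id) (ψ := fun u : ℕ → F => (u 0, fun k => u (1 + k)))
        measurable_id (by fun_prop)
      simpa [Function.comp_def, add_assoc] using h2
    rw [hst]
    exact (IndepFun.prodMk_of_indepFun_prodMk hm (hZ m)
      (measurable_pi_lambda _ fun k => hZ (m + 1 + k)) h1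
      (iIndepFun.indepFun_tail hZ hind m)).comp hΦ measurable_id

/-- Freezing: the expectation of `φ (U, V)` for independent `U`, `V` is computed by first averaging
over `V`. -/
lemma integral_comp_of_indepFun {Ω T F : Type*} [MeasurableSpace Ω] [MeasurableSpace T]
    [MeasurableSpace F] {P : Measure Ω} [IsProbabilityMeasure P] {U : Ω → T} {V : Ω → F}
    (hU : Measurable U) (hV : Measurable V) (hind : IndepFun U V P) {φ : T → F → ℝ}
    (hφ : Measurable (fun q : T × F => φ q.1 q.2))
    (hint : Integrable (fun ω => φ (U ω) (V ω)) P) :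
    Integrable (fun ω => ∫ z, φ (U ω) z ∂(P.map V)) P ∧
    ∫ ω, φ (U ω) (V ω) ∂P = ∫ ω, ∫ z, φ (U ω) z ∂(P.map V) ∂P := by
  have := Measure.isProbabilityMeasure_map (μ := P) hU.aemeasurable
  have := Measure.isProbabilityMeasure_map (μ := P) hV.aemeasurable
  have hmap := (indepFun_iff_map_prod_eq_prod_map_map hU.aemeasurable hV.aemeasurable).1 hind
  have hi : Integrable (fun q : T × F => φ q.1 q.2) ((P.map U).prod (P.map V)) := by
    rw [← hmap]
    exact (integrable_map_measure hφ.aestronglyMeasurable (hU.prodMk hV).aemeasurable).2 hint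
  have hi' := hi.integral_prod_left
  refine ⟨(integrable_map_measure hi'.aestronglyMeasurable hU.aemeasurable).1 hi', ?_⟩
  rw [← integral_map (f := fun x => ∫ z, φ x z ∂(P.map V)) hU.aemeasurable
    hi'.aestronglyMeasurable,
    ← integral_map (f := fun q : T × F => φ q.1 q.2) (hU.prodMk hV).aemeasurable
    hφ.aestronglyMeasurable, hmap, integral_prod _ hi]

/-! ### Noisy vector fields and the chains they drive -/

section Chain

variable {E F Ω : Type*} [NormedAddCommGroup E] [InnerProductSpace ℝ E] [MeasurableSpace F]

/-- A bounded bilinear form is locally Lipschitz on the diagonal. -/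
lemma abs_bilin_sub_le (b : E →L[ℝ] E →L[ℝ] ℝ) (u v : E) :
    |b u u - b v v| ≤ ‖b‖ * (‖u - v‖ ^ 2 + 2 * ‖u - v‖ * ‖v‖) := by
  have h : b u u - b v v = b (u - v) (u - v) + b (u - v) v + b v (u - v) := by
    simp only [map_sub, sub_apply]
    ring
  have h1 := b.le_opNorm₂ (u - v) (u - v)
  have h2 := b.le_opNorm₂ (u - v) v
  have h3 := b.le_opNorm₂ v (u - v)
  rw [Real.norm_eq_abs] at h1 h2 h3
  rw [h]
  linarith [abs_add_three (b (u - v) (u - v)) (b (u - v) v) (b v (u - v)),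
    show ‖b‖ * (‖u - v‖ ^ 2 + 2 * ‖u - v‖ * ‖v‖) = ‖b‖ * ‖u - v‖ * ‖u - v‖
      + ‖b‖ * ‖u - v‖ * ‖v‖ + ‖b‖ * ‖v‖ * ‖u - v‖ by ring]

lemma integrable_bilin_self [MeasurableSpace Ω] {P : Measure Ω} {u : Ω → E} (hu : MemLp u 2 P)
    (b : E →L[ℝ] E →L[ℝ] ℝ) : Integrable (fun ω => b (u ω) (u ω)) P := by
  have hb : Continuous fun v : E => b v v := by fun_prop
  refine ((memLp_two_iff_integrable_sq_norm hu.1).1 hu).const_mul ‖b‖ |>.mono'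
    (hb.comp_aestronglyMeasurable hu.1) (Filter.Eventually.of_forall fun ω => ?_)
  exact (b.le_opNorm₂ (u ω) (u ω)).trans_eq (by ring)

/-- A random vector field `g z`, with `z` distributed according to `ν`, whose mean vanishes at the
origin, is linearised there by `A` up to a quadratic error, and points away from the origin at
least as strongly as `μ • x`. All bounds are global in `x`. -/
structure NoisyField (g : F → E → E) (ν : Measure F) (A : E →L[ℝ] E) (D L μ Q : ℝ) : Prop where
  continuous : ∀ z, Continuous (g z)
  norm_zero_le : ∀ z, ‖g z 0‖ ≤ D
  norm_sub_zero_le : ∀ z x, ‖g z x - g z 0‖ ≤ L * ‖x‖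
  drift : ∀ x, μ * ‖x‖ ^ 2 ≤ inner ℝ x (∫ z, g z x ∂ν)
  linearisation : ∀ x, ‖(∫ z, g z x ∂ν) - A x‖ ≤ Q * ‖x‖ ^ 2

/-- `x` is the chain `x (m + 1) = x m - η g (Z m) (x m)` driven by independent innovations `Z m` of
law `ν` that are independent of the essentially bounded start `x 0`. -/
structure IsChain [MeasurableSpace E] [MeasurableSpace Ω] (P : Measure Ω) (ν : Measure F)
    (g : F → E → E) (η : ℝ) (x : ℕ → Ω → E) (Z : ℕ → Ω → F) : Prop where
  measurable_start : Measurable (x 0)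
  bounded_start : ∃ R, ∀ᵐ ω ∂P, ‖x 0 ω‖ ≤ R
  measurable_innovation : ∀ m, Measurable (Z m)
  law : ∀ m, P.map (Z m) = ν
  indep : iIndepFun Z P
  indep_start : IndepFun (x 0) (fun ω m => Z m ω) P
  step : ∀ m ω, x (m + 1) ω = x m ω - η • g (Z m ω) (x m ω)

/-- The deviation of the random field from its mean. -/
noncomputable def noise (g : F → E → E) (ν : Measure F) (z : F) (x : E) : E :=
  g z x - ∫ z', g z' x ∂ν

/-- The accumulated noise `∑_{j < m} noise (Z j) (x j)` along a chain; a martingale in `m`. -/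
noncomputable def noiseSum (g : F → E → E) (ν : Measure F) (x : ℕ → Ω → E) (Z : ℕ → Ω → F)
    (m : ℕ) (ω : Ω) : E :=
  ∑ j ∈ Finset.range m, noise g ν (Z j ω) (x j ω)

variable {g : F → E → E} {ν : Measure F} {A : E →L[ℝ] E} {D L μ Q : ℝ}

namespace NoisyField

lemma norm_le (h : NoisyField g ν A D L μ Q) (z : F) (x : E) : ‖g z x‖ ≤ D + L * ‖x‖ := by
  have h1 := norm_add_le (g z 0) (g z x - g z 0)
  rw [add_sub_cancel] at h1
  linarith [h.norm_zero_le z, h.norm_sub_zero_le z x]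

lemma norm_sq_le (h : NoisyField g ν A D L μ Q) (z : F) (x : E) :
    ‖g z x‖ ^ 2 ≤ 2 * (D ^ 2 + L ^ 2 * ‖x‖ ^ 2) := by
  have h1 := h.norm_le z x
  have h2 : ‖g z x‖ ^ 2 ≤ (D + L * ‖x‖) ^ 2 := by gcongr
  nlinarith [sq_nonneg (D - L * ‖x‖)]

lemma mean_zero (h : NoisyField g ν A D L μ Q) : ∫ z, g z 0 ∂ν = 0 := by
  simpa using h.linearisation 0

lemma noise_zero (h : NoisyField g ν A D L μ Q) (z : F) : noise g ν z 0 = g z 0 := by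
  simp [noise, h.mean_zero]

variable [Fintype F] [MeasurableSingletonClass F] [IsProbabilityMeasure ν]

lemma norm_noise_sub_zero_le (h : NoisyField g ν A D L μ Q) (z : F) (x : E) :
    ‖noise g ν z x - noise g ν z 0‖ ≤ 2 * L * ‖x‖ := by
  have h1 : noise g ν z x - noise g ν z 0
      = (g z x - g z 0) - ∫ z', (g z' x - g z' 0) ∂ν := by
    rw [integral_sub Integrable.of_finite Integrable.of_finite]
    simp only [noise]
    abel
  have h2 : ‖∫ z', (g z' x - g z' 0) ∂ν‖ ≤ L * ‖x‖ := by
    simpa using norm_integral_le_of_norm_le_const (μ := ν)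
      (Filter.Eventually.of_forall fun z' => h.norm_sub_zero_le z' x)
  rw [h1]
  linarith [norm_sub_le (g z x - g z 0) (∫ z', (g z' x - g z' 0) ∂ν), h.norm_sub_zero_le z x]

/-- The covariance of the noise at `u` differs from the one at the origin by
`O(‖u‖ + ‖u‖ ^ 2)`. -/
lemma abs_noiseCov_sub_le (hg : NoisyField g ν A D L μ Q) (hL : 0 ≤ L)
    (b : E →L[ℝ] E →L[ℝ] ℝ) (u : E) :
    |(∫ z, b (noise g ν z u) (noise g ν z u) ∂ν) - ∫ z, b (g z 0) (g z 0) ∂ν|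
      ≤ ‖b‖ * (4 * L ^ 2 * ‖u‖ ^ 2 + 4 * D * L * ‖u‖) := by
  rw [← integral_sub Integrable.of_finite Integrable.of_finite, ← Real.norm_eq_abs]
  refine (norm_integral_le_of_norm_le_const (μ := ν) (Filter.Eventually.of_forall
    fun z => ?_)).trans_eq (by rw [probReal_univ, mul_one])
  have h1 := abs_bilin_sub_le b (noise g ν z u) (noise g ν z 0)
  have h2 := hg.norm_noise_sub_zero_le z u
  rw [← hg.noise_zero z, Real.norm_eq_abs]
  refine h1.trans ?_
  have h3 : ‖noise g ν z 0‖ ≤ D := by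
    rw [hg.noise_zero]
    exact hg.norm_zero_le z
  refine mul_le_mul_of_nonneg_left ?_ (norm_nonneg b)
  calc ‖noise g ν z u - noise g ν z 0‖ ^ 2 + 2 * ‖noise g ν z u - noise g ν z 0‖ * ‖noise g ν z 0‖
      ≤ (2 * L * ‖u‖) ^ 2 + 2 * (2 * L * ‖u‖) * D := by gcongr
    _ = _ := by ring

variable [FiniteDimensional ℝ E]

lemma continuous_mean (h : NoisyField g ν A D L μ Q) : Continuous fun x => ∫ z, g z x ∂ν := by
  have hc := h.continuous
  simp_rw [integral_fintype Integrable.of_finite]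
  fun_prop

lemma continuous_noise (h : NoisyField g ν A D L μ Q) (z : F) : Continuous (noise g ν z) :=
  (h.continuous z).sub h.continuous_mean

lemma integral_noise (x : E) : ∫ z, noise g ν z x ∂ν = 0 := by
  simp only [noise]
  rw [integral_sub Integrable.of_finite Integrable.of_finite]
  simp

/-- One step of the chain contracts the squared distance to the origin in mean, up to the
variance of the noise. -/
lemma integral_norm_step_sq_le (h : NoisyField g ν A D L μ Q) {η : ℝ} (hη : 0 ≤ η)
    (hL : 2 * η * L ^ 2 ≤ μ) (x : E) :
    ∫ z, ‖x - η • g z x‖ ^ 2 ∂ν ≤ (1 - η * μ) * ‖x‖ ^ 2 + 2 * η ^ 2 * D ^ 2 := by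
  have h1 : ∀ z, ‖x - η • g z x‖ ^ 2
      ≤ ‖x‖ ^ 2 + 2 * η ^ 2 * (D ^ 2 + L ^ 2 * ‖x‖ ^ 2) - 2 * η * inner ℝ x (g z x) := by
    intro z
    rw [norm_sub_sq_real, inner_smul_right, norm_smul, mul_pow, Real.norm_eq_abs, sq_abs]
    nlinarith [mul_le_mul_of_nonneg_left (h.norm_sq_le z x) (sq_nonneg η)]
  calc ∫ z, ‖x - η • g z x‖ ^ 2 ∂ν
      ≤ ∫ z, (‖x‖ ^ 2 + 2 * η ^ 2 * (D ^ 2 + L ^ 2 * ‖x‖ ^ 2) - 2 * η * inner ℝ x (g z x)) ∂ν :=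
        integral_mono Integrable.of_finite Integrable.of_finite h1
    _ = ‖x‖ ^ 2 + 2 * η ^ 2 * (D ^ 2 + L ^ 2 * ‖x‖ ^ 2) - 2 * η * inner ℝ x (∫ z, g z x ∂ν) := by
        rw [integral_sub Integrable.of_finite Integrable.of_finite, integral_const_mul,
          integral_inner Integrable.of_finite]
        simp
    _ ≤ _ := by
        nlinarith [mul_le_mul_of_nonneg_left (h.drift x) hη,
          mul_le_mul_of_nonneg_left hL (mul_nonneg hη (sq_nonneg ‖x‖))]

/-- The analogue of `integral_norm_step_sq_le` for fourth powers. -/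
lemma integral_norm_step_pow_four_le (h : NoisyField g ν A D L μ Q) {η : ℝ} (hη : 0 ≤ η)
    (hη1 : η ≤ 1) (hL : 20 * η * L ^ 2 ≤ μ) (hL4 : 16 * η * L ^ 4 ≤ μ) (x : E) :
    ∫ z, ‖x - η • g z x‖ ^ 4 ∂ν
      ≤ (1 - 2 * (η * μ)) * ‖x‖ ^ 4 + 20 * η ^ 2 * D ^ 2 * ‖x‖ ^ 2 + 16 * η ^ 4 * D ^ 4 := by
  set B := 10 * η ^ 2 * ‖x‖ ^ 2 * (2 * (D ^ 2 + L ^ 2 * ‖x‖ ^ 2))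
    + 16 * η ^ 4 * (D ^ 4 + L ^ 4 * ‖x‖ ^ 4) with hB
  have h1 : ∀ z, ‖x - η • g z x‖ ^ 4
      ≤ ‖x‖ ^ 4 + B - 4 * η * ‖x‖ ^ 2 * inner ℝ x (g z x) := by
    intro z
    have hG := h.norm_sq_le z x
    set G := 2 * (D ^ 2 + L ^ 2 * ‖x‖ ^ 2) with hGdef
    have hG0 : (0 : ℝ) ≤ ‖g z x‖ ^ 2 := by positivity
    have hG2 : (‖g z x‖ ^ 2) ^ 2 ≤ 8 * (D ^ 4 + L ^ 4 * ‖x‖ ^ 4) := by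
      have : (‖g z x‖ ^ 2) ^ 2 ≤ G ^ 2 := by gcongr
      nlinarith [sq_nonneg (D ^ 2 - L ^ 2 * ‖x‖ ^ 2)]
    have hcs : (inner ℝ x (g z x)) ^ 2 ≤ ‖x‖ ^ 2 * ‖g z x‖ ^ 2 := by
      rw [← sq_abs, ← mul_pow]
      gcongr
      exact abs_real_inner_le_norm x (g z x)
    have hcs' : ‖x‖ ^ 2 * ‖g z x‖ ^ 2 ≤ ‖x‖ ^ 2 * G := by gcongr
    have hexp : ‖x - η • g z x‖ ^ 4
        = (‖x‖ ^ 2 + (-2 * η * inner ℝ x (g z x) + η ^ 2 * ‖g z x‖ ^ 2)) ^ 2 := by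
      rw [show ‖x - η • g z x‖ ^ 4 = (‖x - η • g z x‖ ^ 2) ^ 2 by ring,
        norm_sub_sq_real, inner_smul_right, norm_smul, mul_pow, Real.norm_eq_abs, sq_abs]
      ring
    rw [hexp]
    set i := inner ℝ x (g z x)
    have he : (-2 * η * i + η ^ 2 * ‖g z x‖ ^ 2) ^ 2
        ≤ 8 * η ^ 2 * (‖x‖ ^ 2 * G) + 2 * η ^ 4 * (8 * (D ^ 4 + L ^ 4 * ‖x‖ ^ 4)) := by
      have e1 : (-2 * η * i + η ^ 2 * ‖g z x‖ ^ 2) ^ 2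
          ≤ 8 * η ^ 2 * i ^ 2 + 2 * η ^ 4 * (‖g z x‖ ^ 2) ^ 2 := by
        nlinarith [sq_nonneg (2 * η * i + η ^ 2 * ‖g z x‖ ^ 2)]
      have e2 : 8 * η ^ 2 * i ^ 2 ≤ 8 * η ^ 2 * (‖x‖ ^ 2 * G) := by
        gcongr
        exact hcs.trans hcs'
      have e3 : 2 * η ^ 4 * (‖g z x‖ ^ 2) ^ 2
          ≤ 2 * η ^ 4 * (8 * (D ^ 4 + L ^ 4 * ‖x‖ ^ 4)) := by gcongr
      linarith
    have e4 : 2 * η ^ 2 * (‖x‖ ^ 2 * ‖g z x‖ ^ 2) ≤ 2 * η ^ 2 * (‖x‖ ^ 2 * G) := by gcongr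
    rw [hB]
    linarith [he, e4, show (‖x‖ ^ 2 + (-2 * η * i + η ^ 2 * ‖g z x‖ ^ 2)) ^ 2
      = ‖x‖ ^ 4 - 4 * η * ‖x‖ ^ 2 * i + 2 * η ^ 2 * (‖x‖ ^ 2 * ‖g z x‖ ^ 2)
        + (-2 * η * i + η ^ 2 * ‖g z x‖ ^ 2) ^ 2 by ring]
  calc ∫ z, ‖x - η • g z x‖ ^ 4 ∂ν
      ≤ ∫ z, (‖x‖ ^ 4 + B - 4 * η * ‖x‖ ^ 2 * inner ℝ x (g z x)) ∂ν :=
        integral_mono Integrable.of_finite Integrable.of_finite h1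
    _ = ‖x‖ ^ 4 + B - 4 * η * ‖x‖ ^ 2 * inner ℝ x (∫ z, g z x ∂ν) := by
        rw [integral_sub Integrable.of_finite Integrable.of_finite, integral_const_mul,
          integral_inner Integrable.of_finite]
        simp
    _ ≤ _ := by
        have e1 : 4 * η * ‖x‖ ^ 2 * (μ * ‖x‖ ^ 2)
            ≤ 4 * η * ‖x‖ ^ 2 * inner ℝ x (∫ z, g z x ∂ν) := by
          gcongr
          exact h.drift x
        have e2 : η * ‖x‖ ^ 4 * (20 * η * L ^ 2) ≤ η * ‖x‖ ^ 4 * μ := by gcongr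
        have e3 : 16 * η ^ 4 * (L ^ 4 * ‖x‖ ^ 4) ≤ η * ‖x‖ ^ 4 * (16 * η * L ^ 4) := by
          have : η ^ 4 ≤ η ^ 2 := pow_le_pow_of_le_one hη hη1 (by norm_num)
          have h0 : 0 ≤ 16 * (L ^ 4 * ‖x‖ ^ 4) := by positivity
          nlinarith
        have e4 : η * ‖x‖ ^ 4 * (16 * η * L ^ 4) ≤ η * ‖x‖ ^ 4 * μ := by gcongr
        rw [hB]
        nlinarith

end NoisyField

variable [Fintype F] [MeasurableSingletonClass F] [IsProbabilityMeasure ν]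
variable [FiniteDimensional ℝ E]

/-! ### Moment bounds along the chain -/

namespace IsChain

variable [MeasurableSpace E] [BorelSpace E] [MeasurableSpace Ω] {P : Measure Ω}
  [IsProbabilityMeasure P] {η : ℝ} {x : ℕ → Ω → E} {Z : ℕ → Ω → F}

/-- The pair of iterate and accumulated noise is a Markov chain: it is independent of the next
innovation. -/
lemma indepFun_pair (hx : IsChain P ν g η x Z) (hg : NoisyField g ν A D L μ Q) (m : ℕ) :
    Measurable (fun ω => (x m ω, noiseSum g ν x Z m ω)) ∧
    IndepFun (fun ω => (x m ω, noiseSum g ν x Z m ω)) (Z m) P := by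
  have : CompleteSpace E := FiniteDimensional.complete ℝ E
  have : ProperSpace E := FiniteDimensional.proper_real E
  have hΦ : Measurable fun q : (E × E) × F =>
      (q.1.1 - η • g q.2 q.1.1, q.1.2 + noise g ν q.2 q.1.1) := by
    refine measurable_from_prod_countable_left fun z => ?_
    have h1 := hg.continuous z
    have h2 := hg.continuous_noise z
    have h3 : Continuous fun q : E × E => (q.1 - η • g z q.1, q.2 + noise g ν z q.1) := by
      fun_prop
    exact h3.measurable
  have h0 : (fun ω => (x 0 ω, noiseSum g ν x Z 0 ω)) = (fun u => (u, (0 : E))) ∘ x 0 := by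
    funext ω
    simp [noiseSum]
  refine indepFun_state (s := fun m ω => (x m ω, noiseSum g ν x Z m ω)) hx.measurable_innovation
    hx.indep ?_ ?_ hΦ (fun m ω => ?_) m
  · rw [h0]
    exact Measurable.comp (by fun_prop) hx.measurable_start
  · rw [h0]
    exact hx.indep_start.comp (φ := fun u => (u, (0 : E))) (ψ := id) (by fun_prop) measurable_id
  · simp only [noiseSum, Finset.sum_range_succ, hx.step]

omit [BorelSpace E] [IsProbabilityMeasure P] in
lemma exists_bound (hx : IsChain P ν g η x Z) (hg : NoisyField g ν A D L μ Q) (m : ℕ) :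
    ∃ R, ∀ᵐ ω ∂P, ‖(x m ω, noiseSum g ν x Z m ω)‖ ≤ R := by
  have : ProperSpace E := FiniteDimensional.proper_real E
  induction m with
  | zero =>
    obtain ⟨R, hR⟩ := hx.bounded_start
    refine ⟨R, hR.mono fun ω hω => ?_⟩
    simp only [noiseSum, Finset.range_zero, Finset.sum_empty, Prod.norm_def, norm_zero]
    exact max_le hω ((norm_nonneg _).trans hω)
  | succ m ih =>
    obtain ⟨R, hR⟩ := ih
    have hc : ∀ z, Continuous fun q : E × E => (q.1 - η • g z q.1, q.2 + noise g ν z q.1) := by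
      intro z
      have h1 := hg.continuous z
      have h2 := hg.continuous_noise z
      fun_prop
    choose C hC using fun z =>
      (isCompact_closedBall (0 : E × E) R).exists_bound_of_continuousOn (hc z).continuousOn
    refine ⟨∑ z, |C z|, hR.mono fun ω hω => ?_⟩
    have h1 := hC (Z m ω) (x m ω, noiseSum g ν x Z m ω) (by simpa using hω)
    have h2 : |C (Z m ω)| ≤ ∑ z, |C z| :=
      Finset.single_le_sum (f := fun z => |C z|) (fun z _ => abs_nonneg _) (Finset.mem_univ _)
    have h3 : (x (m + 1) ω, noiseSum g ν x Z (m + 1) ω) = (x m ω - η • g (Z m ω) (x m ω),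
        noiseSum g ν x Z m ω + noise g ν (Z m ω) (x m ω)) := by
      simp only [noiseSum, Finset.sum_range_succ, hx.step]
    rw [h3]
    exact h1.trans ((le_abs_self _).trans h2)

/-- Averaging over the next innovation first. Integrability is automatic, as the chain is
essentially bounded at every fixed time. -/
lemma integral_next (hx : IsChain P ν g η x Z) (hg : NoisyField g ν A D L μ Q)
    {φ : F → E × E → ℝ} (hφ : ∀ z, Continuous (φ z)) (m : ℕ) :
    Integrable (fun ω => φ (Z m ω) (x m ω, noiseSum g ν x Z m ω)) P ∧
    Integrable (fun ω => ∫ z, φ z (x m ω, noiseSum g ν x Z m ω) ∂ν) P ∧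
    ∫ ω, φ (Z m ω) (x m ω, noiseSum g ν x Z m ω) ∂P
      = ∫ ω, ∫ z, φ z (x m ω, noiseSum g ν x Z m ω) ∂ν ∂P := by
  have : ProperSpace E := FiniteDimensional.proper_real E
  obtain ⟨hmeas, hind⟩ := hx.indepFun_pair hg m
  have hφm : Measurable fun q : (E × E) × F => φ q.2 q.1 :=
    measurable_from_prod_countable_left fun z => (hφ z).measurable
  have hint : Integrable (fun ω => φ (Z m ω) (x m ω, noiseSum g ν x Z m ω)) P := by
    obtain ⟨R, hR⟩ := hx.exists_bound hg m
    choose C hC using fun z =>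
      (isCompact_closedBall (0 : E × E) R).exists_bound_of_continuousOn (hφ z).continuousOn
    refine Integrable.of_bound
      (hφm.comp (hmeas.prodMk (hx.measurable_innovation m))).aestronglyMeasurable (∑ z, |C z|)
      (hR.mono fun ω hω => ?_)
    have h1 := hC (Z m ω) (x m ω, noiseSum g ν x Z m ω) (by simpa using hω)
    exact h1.trans ((le_abs_self _).trans
      (Finset.single_le_sum (f := fun z => |C z|) (fun z _ => abs_nonneg _) (Finset.mem_univ _)))
  have h := integral_comp_of_indepFun (φ := fun q z => φ z q) hmeas (hx.measurable_innovation m)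
    hind hφm hint
  rw [hx.law m] at h
  exact ⟨hint, h⟩

lemma integrable_pair (hx : IsChain P ν g η x Z) (hg : NoisyField g ν A D L μ Q)
    {ψ : E × E → ℝ} (hψ : Continuous ψ) (m : ℕ) :
    Integrable (fun ω => ψ (x m ω, noiseSum g ν x Z m ω)) P :=
  (hx.integral_next hg (φ := fun _ => ψ) (fun _ => hψ) m).1

lemma integrable_comp (hx : IsChain P ν g η x Z) (hg : NoisyField g ν A D L μ Q)
    {ψ : E → ℝ} (hψ : Continuous ψ) (m : ℕ) : Integrable (fun ω => ψ (x m ω)) P :=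
  hx.integrable_pair hg (ψ := fun q => ψ q.1) (hψ.comp continuous_fst) m

lemma integral_succ_le (hx : IsChain P ν g η x Z) (hg : NoisyField g ν A D L μ Q)
    {ψ ψ' : E → ℝ} (hψ : Continuous ψ) (hψ' : Continuous ψ')
    (hle : ∀ u, ∫ z, ψ (u - η • g z u) ∂ν ≤ ψ' u) (m : ℕ) :
    ∫ ω, ψ (x (m + 1) ω) ∂P ≤ ∫ ω, ψ' (x m ω) ∂P := by
  obtain ⟨-, h2, h3⟩ := hx.integral_next hg (φ := fun z q => ψ (q.1 - η • g z q.1))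
    (fun z => by
      have := hg.continuous z
      fun_prop) m
  simp_rw [hx.step]
  rw [h3]
  exact integral_mono h2 (hx.integrable_comp hg hψ' m) fun ω => hle _

/-- The iterates stay within distance of order `√η` of the origin, in mean square. -/
lemma integral_norm_sq_le (hx : IsChain P ν g η x Z) (hg : NoisyField g ν A D L μ Q)
    (hη : 0 ≤ η) (hL : 2 * η * L ^ 2 ≤ μ) (hημ : η * μ ≤ 1) {R : ℝ} (hR : 2 * D ^ 2 ≤ μ * R)
    (h0 : ∫ ω, ‖x 0 ω‖ ^ 2 ∂P ≤ R * η) (m : ℕ) : ∫ ω, ‖x m ω‖ ^ 2 ∂P ≤ R * η := by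
  induction m with
  | zero => exact h0
  | succ m ih =>
    have h1 := hx.integral_succ_le hg (ψ := fun u => ‖u‖ ^ 2)
      (ψ' := fun u => (1 - η * μ) * ‖u‖ ^ 2 + 2 * η ^ 2 * D ^ 2) (by fun_prop) (by fun_prop)
      (hg.integral_norm_step_sq_le hη hL) m
    have hi := hx.integrable_comp hg (ψ := fun u => ‖u‖ ^ 2) (by fun_prop) m
    rw [integral_add (hi.const_mul _) (integrable_const _), integral_const_mul] at h1
    simp only [integral_const, probReal_univ, one_smul] at h1
    have h2 : (1 - η * μ) * ∫ ω, ‖x m ω‖ ^ 2 ∂P ≤ (1 - η * μ) * (R * η) :=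
      mul_le_mul_of_nonneg_left ih (by linarith)
    nlinarith [mul_le_mul_of_nonneg_left hR (sq_nonneg η)]

/-- The fourth moments are of order `η ^ 2`. -/
lemma integral_norm_pow_four_le (hx : IsChain P ν g η x Z) (hg : NoisyField g ν A D L μ Q)
    (hη : 0 ≤ η) (hη1 : η ≤ 1) (hL : 20 * η * L ^ 2 ≤ μ) (hL4 : 16 * η * L ^ 4 ≤ μ)
    (hημ : 2 * (η * μ) ≤ 1) {R R₄ : ℝ} (hR : ∀ m, ∫ ω, ‖x m ω‖ ^ 2 ∂P ≤ R * η)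
    (hR₄ : 10 * D ^ 2 * R + 8 * D ^ 4 ≤ μ * R₄)
    (h0 : ∫ ω, ‖x 0 ω‖ ^ 4 ∂P ≤ R₄ * η ^ 2) (m : ℕ) :
    ∫ ω, ‖x m ω‖ ^ 4 ∂P ≤ R₄ * η ^ 2 := by
  induction m with
  | zero => exact h0
  | succ m ih =>
    have h1 := hx.integral_succ_le hg (ψ := fun u => ‖u‖ ^ 4)
      (ψ' := fun u => (1 - 2 * (η * μ)) * ‖u‖ ^ 4 + 20 * η ^ 2 * D ^ 2 * ‖u‖ ^ 2
        + 16 * η ^ 4 * D ^ 4) (by fun_prop) (by fun_prop)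
      (hg.integral_norm_step_pow_four_le hη hη1 hL hL4) m
    have hi := hx.integrable_comp hg (ψ := fun u => ‖u‖ ^ 2) (by fun_prop) m
    have hi4 := hx.integrable_comp hg (ψ := fun u => ‖u‖ ^ 4) (by fun_prop) m
    have hs : Integrable (fun ω => (1 - 2 * (η * μ)) * ‖x m ω‖ ^ 4
        + 20 * η ^ 2 * D ^ 2 * ‖x m ω‖ ^ 2) P := (hi4.const_mul _).add (hi.const_mul _)
    rw [integral_add hs (integrable_const _),
      integral_add (hi4.const_mul _) (hi.const_mul _), integral_const_mul,
      integral_const_mul] at h1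
    simp only [integral_const, probReal_univ, one_smul] at h1
    have h2 : (1 - 2 * (η * μ)) * ∫ ω, ‖x m ω‖ ^ 4 ∂P ≤ (1 - 2 * (η * μ)) * (R₄ * η ^ 2) :=
      mul_le_mul_of_nonneg_left ih (by linarith)
    have h3 : 20 * η ^ 2 * D ^ 2 * ∫ ω, ‖x m ω‖ ^ 2 ∂P ≤ 20 * η ^ 2 * D ^ 2 * (R * η) :=
      mul_le_mul_of_nonneg_left (hR m) (by positivity)
    have h4 : 16 * η ^ 4 * D ^ 4 ≤ 16 * η ^ 3 * D ^ 4 := by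
      have : η ^ 4 ≤ η ^ 3 := pow_le_pow_of_le_one hη hη1 (by norm_num)
      gcongr
    have h5 := mul_le_mul_of_nonneg_left hR₄ (pow_nonneg hη 3)
    nlinarith

/-! ### Covariance of the accumulated noise -/

/-- The increments of the noise martingale are orthogonal with respect to every bilinear form. -/
lemma integral_bilin_noiseSum (hx : IsChain P ν g η x Z) (hg : NoisyField g ν A D L μ Q)
    (b : E →L[ℝ] E →L[ℝ] ℝ) (t : ℕ) :
    ∫ ω, b (noiseSum g ν x Z t ω) (noiseSum g ν x Z t ω) ∂P
      = ∑ m ∈ Finset.range t,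
          ∫ ω, ∫ z, b (noise g ν z (x m ω)) (noise g ν z (x m ω)) ∂ν ∂P := by
  have : CompleteSpace E := FiniteDimensional.complete ℝ E
  have hcn := hg.continuous_noise
  induction t with
  | zero => simp [noiseSum]
  | succ m ih =>
    have h := (hx.integral_next hg
      (φ := fun z q => b (q.2 + noise g ν z q.1) (q.2 + noise g ν z q.1))
      (fun z => by fun_prop) m).2.2
    have hstep : ∀ u s : E, ∫ z, b (s + noise g ν z u) (s + noise g ν z u) ∂ν
        = b s s + ∫ z, b (noise g ν z u) (noise g ν z u) ∂ν := by
      intro u s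
      have e1 : ∀ z, b (s + noise g ν z u) (s + noise g ν z u)
          = b s s + b.flip s (noise g ν z u) + b s (noise g ν z u)
            + b (noise g ν z u) (noise g ν z u) := by
        intro z
        simp only [map_add, add_apply, ContinuousLinearMap.flip_apply]
        ring
      have e2 : ∀ T : E →L[ℝ] ℝ, ∫ z, T (noise g ν z u) ∂ν = 0 := fun T => by
        rw [ContinuousLinearMap.integral_comp_comm _ Integrable.of_finite,
          NoisyField.integral_noise, map_zero]
      simp_rw [e1]
      rw [integral_add Integrable.of_finite Integrable.of_finite,
        integral_add Integrable.of_finite Integrable.of_finite,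
        integral_add Integrable.of_finite Integrable.of_finite,
        e2, e2]
      simp
    simp_rw [hstep] at h
    rw [integral_add (hx.integrable_pair hg (ψ := fun q => b q.2 q.2) (by fun_prop) m)
      (hx.integral_next hg (φ := fun z q => b (noise g ν z q.1) (noise g ν z q.1))
        (fun z => by fun_prop) m).2.1, ih] at h
    rw [Finset.sum_range_succ, ← h]
    simp only [noiseSum, Finset.sum_range_succ]

end IsChain

/-! ### Covariance of the averaged chain -/

/-- What is left of `A (∑_{m < t} x m)` after the noise has been split off: the telescoped
displacement and the accumulated linearisation errors. -/
noncomputable def remainder (g : F → E → E) (ν : Measure F) (A : E →L[ℝ] E) (η : ℝ)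
    (x : ℕ → Ω → E) (t : ℕ) (ω : Ω) : E :=
  η⁻¹ • (x 0 ω - x t ω) - ∑ m ∈ Finset.range t, ((∫ z, g z (x m ω) ∂ν) - A (x m ω))

namespace IsChain

variable [MeasurableSpace E] [BorelSpace E] [MeasurableSpace Ω] {P : Measure Ω}
  [IsProbabilityMeasure P] {η : ℝ} {x : ℕ → Ω → E} {Z : ℕ → Ω → F}

lemma memLp_pair (hx : IsChain P ν g η x Z) (hg : NoisyField g ν A D L μ Q)
    {ψ : E × E → E} (hψ : Continuous ψ) (m : ℕ) :
    MemLp (fun ω => ψ (x m ω, noiseSum g ν x Z m ω)) 2 P := by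
  have : ProperSpace E := FiniteDimensional.proper_real E
  refine (memLp_two_iff_integrable_sq_norm ?_).2
    (hx.integrable_pair hg (ψ := fun q => ‖ψ q‖ ^ 2) (by fun_prop) m)
  exact (hψ.measurable.comp (hx.indepFun_pair hg m).1).aestronglyMeasurable

lemma memLp_comp (hx : IsChain P ν g η x Z) (hg : NoisyField g ν A D L μ Q)
    {ψ : E → E} (hψ : Continuous ψ) (m : ℕ) : MemLp (fun ω => ψ (x m ω)) 2 P :=
  hx.memLp_pair hg (ψ := fun q => ψ q.1) (hψ.comp continuous_fst) m

lemma memLp_sum (hx : IsChain P ν g η x Z) (hg : NoisyField g ν A D L μ Q) (t : ℕ) :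
    MemLp (fun ω => ∑ m ∈ Finset.range t, x m ω) 2 P :=
  memLp_finsetSum _ fun m _ => hx.memLp_comp hg (ψ := id) continuous_id m

omit [Fintype F] [MeasurableSingletonClass F] [IsProbabilityMeasure ν] [FiniteDimensional ℝ E]
  [BorelSpace E] [IsProbabilityMeasure P] in
/-- Summation of the recursion expresses the sum of the iterates through the noise. -/
lemma map_sum_eq (hx : IsChain P ν g η x Z) (hη : η ≠ 0) (t : ℕ) (ω : Ω) :
    A (∑ m ∈ Finset.range t, x m ω)
      = remainder g ν A η x t ω - noiseSum g ν x Z t ω := by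
  induction t with
  | zero => simp [remainder, noiseSum]
  | succ t ih =>
    have h : η⁻¹ • (x 0 ω - x (t + 1) ω) = η⁻¹ • (x 0 ω - x t ω) + g (Z t ω) (x t ω) := by
      rw [hx.step t ω, sub_sub_eq_add_sub, add_sub_right_comm, smul_add, smul_smul,
        inv_mul_cancel₀ hη, one_smul]
    rw [Finset.sum_range_succ, map_add, ih]
    simp only [remainder, noiseSum, Finset.sum_range_succ, noise] at h ⊢
    rw [h]
    abel

lemma memLp_remainder (hx : IsChain P ν g η x Z) (hg : NoisyField g ν A D L μ Q) (t : ℕ) :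
    MemLp (remainder g ν A η x t) 2 P := by
  have h1 := hx.memLp_comp hg (ψ := id) continuous_id
  refine (((h1 0).sub (h1 t)).const_smul η⁻¹).sub (memLp_finsetSum _ fun m _ => ?_)
  exact hx.memLp_comp hg (ψ := fun u => (∫ z, g z u ∂ν) - A u)
    (hg.continuous_mean.sub A.continuous) m

/-- The displacement contributes `O(1 / η)` and the linearisation errors `O(t² η²)`. -/
lemma integral_remainder_sq_le (hx : IsChain P ν g η x Z) (hg : NoisyField g ν A D L μ Q)
    (hη : 0 < η) {R R₄ : ℝ} (hR : ∀ m, ∫ ω, ‖x m ω‖ ^ 2 ∂P ≤ R * η)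
    (hR₄ : ∀ m, ∫ ω, ‖x m ω‖ ^ 4 ∂P ≤ R₄ * η ^ 2) (t : ℕ) :
    ∫ ω, ‖remainder g ν A η x t ω‖ ^ 2 ∂P
      ≤ 8 * R / η + 2 * t ^ 2 * Q ^ 2 * R₄ * η ^ 2 := by
  have hpt : ∀ ω, ‖remainder g ν A η x t ω‖ ^ 2
      ≤ 4 * (η⁻¹) ^ 2 * (‖x 0 ω‖ ^ 2 + ‖x t ω‖ ^ 2)
        + 2 * t * Q ^ 2 * ∑ m ∈ Finset.range t, ‖x m ω‖ ^ 4 := by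
    intro ω
    set p := η⁻¹ • (x 0 ω - x t ω) with hp
    set q := ∑ m ∈ Finset.range t, ((∫ z, g z (x m ω) ∂ν) - A (x m ω)) with hq
    have h1 : ‖p‖ ^ 2 ≤ 2 * (η⁻¹) ^ 2 * (‖x 0 ω‖ ^ 2 + ‖x t ω‖ ^ 2) := by
      rw [hp, norm_smul, mul_pow, Real.norm_eq_abs, sq_abs]
      have h2 : ‖x 0 ω - x t ω‖ ^ 2 ≤ (‖x 0 ω‖ + ‖x t ω‖) ^ 2 := by
        gcongr
        exact norm_sub_le _ _
      have h3 : ‖x 0 ω - x t ω‖ ^ 2 ≤ 2 * (‖x 0 ω‖ ^ 2 + ‖x t ω‖ ^ 2) := by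
        nlinarith [sq_nonneg (‖x 0 ω‖ - ‖x t ω‖)]
      nlinarith [mul_le_mul_of_nonneg_left h3 (sq_nonneg η⁻¹)]
    have h2 : ‖q‖ ^ 2 ≤ t * Q ^ 2 * ∑ m ∈ Finset.range t, ‖x m ω‖ ^ 4 := by
      have e1 : ‖q‖ ≤ ∑ m ∈ Finset.range t, Q * ‖x m ω‖ ^ 2 :=
        (norm_sum_le _ _).trans (Finset.sum_le_sum fun m _ => hg.linearisation _)
      calc ‖q‖ ^ 2 ≤ (∑ m ∈ Finset.range t, Q * ‖x m ω‖ ^ 2) ^ 2 := by gcongr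
        _ ≤ (Finset.range t).card * ∑ m ∈ Finset.range t, (Q * ‖x m ω‖ ^ 2) ^ 2 :=
          sq_sum_le_card_mul_sum_sq
        _ = t * Q ^ 2 * ∑ m ∈ Finset.range t, ‖x m ω‖ ^ 4 := by
          rw [Finset.card_range, Finset.mul_sum, Finset.mul_sum]
          exact Finset.sum_congr rfl fun m _ => by ring
    have h3 : ‖remainder g ν A η x t ω‖ ^ 2 ≤ (‖p‖ + ‖q‖) ^ 2 := by
      gcongr
      exact norm_sub_le _ _
    nlinarith [sq_nonneg (‖p‖ - ‖q‖)]
  have i2 : ∀ m, Integrable (fun ω => ‖x m ω‖ ^ 2) P := fun m =>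
    hx.integrable_comp hg (ψ := fun u => ‖u‖ ^ 2) (by fun_prop) m
  have i4 : ∀ m, Integrable (fun ω => ‖x m ω‖ ^ 4) P := fun m =>
    hx.integrable_comp hg (ψ := fun u => ‖u‖ ^ 4) (by fun_prop) m
  have j1 : Integrable (fun ω => 4 * (η⁻¹) ^ 2 * (‖x 0 ω‖ ^ 2 + ‖x t ω‖ ^ 2)) P :=
    ((i2 0).add (i2 t)).const_mul _
  have j2 : Integrable (fun ω => 2 * t * Q ^ 2 * ∑ m ∈ Finset.range t, ‖x m ω‖ ^ 4) P :=
    (integrable_finsetSum _ fun m _ => i4 m).const_mul _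
  have h1 := integral_mono ((memLp_two_iff_integrable_sq_norm
    (hx.memLp_remainder hg t).1).1 (hx.memLp_remainder hg t)) (j1.add j2) hpt
  simp only [Pi.add_apply] at h1
  rw [integral_add j1 j2, integral_const_mul, integral_const_mul, integral_add (i2 0) (i2 t),
    integral_finsetSum _ fun m _ => i4 m] at h1
  have h2 : ∑ m ∈ Finset.range t, ∫ ω, ‖x m ω‖ ^ 4 ∂P ≤ t * (R₄ * η ^ 2) := by
    refine (Finset.sum_le_sum fun m _ => hR₄ m).trans_eq ?_
    simp
  have h3 : 4 * (η⁻¹) ^ 2 * ((∫ ω, ‖x 0 ω‖ ^ 2 ∂P) + ∫ ω, ‖x t ω‖ ^ 2 ∂P)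
      ≤ 4 * (η⁻¹) ^ 2 * (R * η + R * η) := by
    gcongr
    exacts [hR 0, hR t]
  have h4 : 2 * t * Q ^ 2 * ∑ m ∈ Finset.range t, ∫ ω, ‖x m ω‖ ^ 4 ∂P
      ≤ 2 * t * Q ^ 2 * (t * (R₄ * η ^ 2)) := by gcongr
  have h5 : 4 * (η⁻¹) ^ 2 * (R * η + R * η) = 8 * R / η := by
    field_simp
    ring
  linarith [show 2 * t * Q ^ 2 * (t * (R₄ * η ^ 2)) = 2 * (t : ℝ) ^ 2 * Q ^ 2 * R₄ * η ^ 2 by ring]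

/-- Up to `O(t √η)`, the covariance of the accumulated noise is `t` times the one at the origin. -/
lemma abs_integral_bilin_noiseSum_sub_le (hx : IsChain P ν g η x Z)
    (hg : NoisyField g ν A D L μ Q) (hD : 0 ≤ D) (hL : 0 ≤ L) (hη : 0 < η) (hη1 : η ≤ 1) {R : ℝ}
    (hR : ∀ m, ∫ ω, ‖x m ω‖ ^ 2 ∂P ≤ R * η) (b : E →L[ℝ] E →L[ℝ] ℝ) (t : ℕ) :
    |(∫ ω, b (noiseSum g ν x Z t ω) (noiseSum g ν x Z t ω) ∂P)
        - t * ∫ z, b (g z 0) (g z 0) ∂ν|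
      ≤ t * (‖b‖ * ((4 * L ^ 2 * R + 2 * D * L * (R + 1)) * √η)) := by
  have hs : 0 < √η := Real.sqrt_pos.2 hη
  have hss : √η * √η = η := Real.mul_self_sqrt hη.le
  have hs1 : √η ≤ 1 := Real.sqrt_le_one.2 hη1
  have hR0 : 0 ≤ R := by
    have h1 : 0 ≤ ∫ ω, ‖x 0 ω‖ ^ 2 ∂P := integral_nonneg fun ω => by positivity
    exact nonneg_of_mul_nonneg_left (h1.trans (hR 0)) hη
  set Γ := ∫ z, b (g z 0) (g z 0) ∂ν
  rw [hx.integral_bilin_noiseSum hg b t,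
    show (t : ℝ) * Γ = ∑ m ∈ Finset.range t, Γ by simp, ← Finset.sum_sub_distrib]
  refine (Finset.abs_sum_le_sum_abs _ _).trans
    ((Finset.sum_le_card_nsmul _ _ _ fun m _ => ?_).trans_eq (by rw [Finset.card_range,
      nsmul_eq_mul]))
  have hc := hg.continuous_noise
  have i1 := (hx.integral_next hg
    (φ := fun z q => b (noise g ν z q.1) (noise g ν z q.1)) (fun z => by fun_prop) m).2.1
  have i2 : Integrable (fun ω => ‖x m ω‖ ^ 2) P :=
    hx.integrable_comp hg (ψ := fun u => ‖u‖ ^ 2) (by fun_prop) m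
  -- `‖u‖ ≤ (‖u‖² / √η + √η) / 2` bounds the first moment by the second one
  have hpt : ∀ ω, |(∫ z, b (noise g ν z (x m ω)) (noise g ν z (x m ω)) ∂ν) - Γ|
      ≤ ‖b‖ * ((4 * L ^ 2 + 2 * D * L * (√η)⁻¹) * ‖x m ω‖ ^ 2 + 2 * D * L * √η) := by
    intro ω
    refine (hg.abs_noiseCov_sub_le hL b (x m ω)).trans ?_
    refine mul_le_mul_of_nonneg_left ?_ (norm_nonneg b)
    have h1 : 2 * ‖x m ω‖ ≤ (√η)⁻¹ * ‖x m ω‖ ^ 2 + √η := by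
      have h2 : (√η)⁻¹ * ‖x m ω‖ ^ 2 + √η - 2 * ‖x m ω‖
          = (√η)⁻¹ * (‖x m ω‖ - √η) ^ 2 := by
        field_simp
        ring
      have h3 : 0 ≤ (√η)⁻¹ * (‖x m ω‖ - √η) ^ 2 := by positivity
      linarith
    nlinarith [mul_le_mul_of_nonneg_left h1 (mul_nonneg hD hL)]
  have h1 : |(∫ ω, ∫ z, b (noise g ν z (x m ω)) (noise g ν z (x m ω)) ∂ν ∂P) - Γ|
      ≤ ∫ ω, ‖b‖ * ((4 * L ^ 2 + 2 * D * L * (√η)⁻¹) * ‖x m ω‖ ^ 2 + 2 * D * L * √η) ∂P := by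
    have e1 : (∫ ω, ∫ z, b (noise g ν z (x m ω)) (noise g ν z (x m ω)) ∂ν ∂P) - Γ
        = ∫ ω, ((∫ z, b (noise g ν z (x m ω)) (noise g ν z (x m ω)) ∂ν) - Γ) ∂P := by
      rw [integral_sub i1 (integrable_const _)]
      simp
    rw [e1, ← Real.norm_eq_abs]
    exact norm_integral_le_of_norm_le
      (((i2.const_mul _).add (integrable_const _)).const_mul _)
      (Filter.Eventually.of_forall hpt)
  refine h1.trans ?_
  rw [integral_const_mul, integral_add (i2.const_mul _) (integrable_const _), integral_const_mul]
  simp only [integral_const, probReal_univ, one_smul]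
  refine mul_le_mul_of_nonneg_left ?_ (norm_nonneg b)
  have h2 : (4 * L ^ 2 + 2 * D * L * (√η)⁻¹) * ∫ ω, ‖x m ω‖ ^ 2 ∂P
      ≤ (4 * L ^ 2 + 2 * D * L * (√η)⁻¹) * (R * η) :=
    mul_le_mul_of_nonneg_left (hR m) (by positivity)
  have h3 : (√η)⁻¹ * η = √η := by
    nth_rw 2 [← hss]
    field_simp
  have h4 : 4 * L ^ 2 * R * η ≤ 4 * L ^ 2 * R * √η := by
    have : η ≤ √η := by nlinarith
    gcongr
  have h5 : (4 * L ^ 2 + 2 * D * L * (√η)⁻¹) * (R * η)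
      = 4 * L ^ 2 * R * η + 2 * D * L * R * ((√η)⁻¹ * η) := by ring
  rw [h3] at h5
  linarith

/-- The covariance estimate for the average of a chain: `A E[x̄ x̄ᵀ] A` times `t` is close to the
covariance of the noise at the origin. The constant depends only on the listed bounds. -/
theorem abs_integral_bilin_sub_le (hx : IsChain P ν g η x Z)
    (hg : NoisyField g ν A D L μ Q) (hD : 0 ≤ D) (hL : 0 ≤ L) (hη : 0 < η) (hη1 : η ≤ 1)
    {R R₄ M : ℝ} (hR : ∀ m, ∫ ω, ‖x m ω‖ ^ 2 ∂P ≤ R * η)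
    (hR₄ : ∀ m, ∫ ω, ‖x m ω‖ ^ 4 ∂P ≤ R₄ * η ^ 2) (b : E →L[ℝ] E →L[ℝ] ℝ) {t : ℕ} (ht : 1 ≤ t)
    (htM : t * η ^ 2 ≤ M) :
    |(t : ℝ)⁻¹ * (∫ ω, b (A (∑ m ∈ Finset.range t, x m ω)) (A (∑ m ∈ Finset.range t, x m ω)) ∂P)
        - ∫ z, b (g z 0) (g z 0) ∂ν|
      ≤ ‖b‖ * ((4 * L ^ 2 * R + 2 * D * L * (R + 1))
          + (D ^ 2 + (4 * L ^ 2 * R + 2 * D * L * (R + 1)))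
          + (8 * R + 2 * Q ^ 2 * R₄) * (1 + √(1 + M)) + (‖A‖ ^ 2 * R + D ^ 2))
        * (√η + √(1 / (t * η) + t * η ^ 2)) := by
  have ht0 : (0 : ℝ) < t := by exact_mod_cast ht
  have hM : 0 < M := lt_of_lt_of_le (by positivity) htM
  have hR0 : 0 ≤ R := by
    have h1 : 0 ≤ ∫ ω, ‖x 0 ω‖ ^ 2 ∂P := integral_nonneg fun ω => by positivity
    exact nonneg_of_mul_nonneg_left (h1.trans (hR 0)) hη
  have hR₄0 : 0 ≤ R₄ := by
    have h1 : 0 ≤ ∫ ω, ‖x 0 ω‖ ^ 4 ∂P := integral_nonneg fun ω => by positivity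
    exact nonneg_of_mul_nonneg_left (h1.trans (hR₄ 0)) (by positivity)
  set C₂ := 4 * L ^ 2 * R + 2 * D * L * (R + 1) with hC₂
  set C₄ := 8 * R + 2 * Q ^ 2 * R₄ with hC₄
  have hC₂0 : 0 ≤ C₂ := by positivity
  have hC₄0 : 0 ≤ C₄ := by positivity
  set ρ := 1 / (t * η) + t * η ^ 2 with hρ
  have hρ0 : 0 < ρ := by positivity
  have hs : 0 < √ρ := Real.sqrt_pos.2 hρ0
  have hss : √ρ * √ρ = ρ := Real.mul_self_sqrt hρ0.le
  set Γ := ∫ z, b (g z 0) (g z 0) ∂ν with hΓ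
  have hΓle : ∀ b' : E →L[ℝ] E →L[ℝ] ℝ, |∫ z, b' (g z 0) (g z 0) ∂ν| ≤ ‖b'‖ * D ^ 2 := by
    intro b'
    rw [← Real.norm_eq_abs]
    refine (norm_integral_le_of_norm_le_const (μ := ν) (Filter.Eventually.of_forall
      fun z => ?_)).trans_eq (by rw [probReal_univ, mul_one])
    refine (b'.le_opNorm₂ (g z 0) (g z 0)).trans ?_
    rw [mul_assoc, ← sq]
    have := hg.norm_zero_le z
    gcongr
  by_cases htη : t * η < 1
  · -- here `ρ > 1`, and both terms are bounded separately
    have hρ1 : 1 ≤ √ρ := by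
      rw [Real.one_le_sqrt, hρ]
      have : 1 ≤ 1 / (t * η) := by
        rw [le_div_iff₀ (by positivity)]
        linarith
      have : 0 ≤ t * η ^ 2 := by positivity
      linarith
    have hpt : ∀ ω, ‖b (A (∑ m ∈ Finset.range t, x m ω)) (A (∑ m ∈ Finset.range t, x m ω))‖
        ≤ ‖b‖ * ‖A‖ ^ 2 * (t * ∑ m ∈ Finset.range t, ‖x m ω‖ ^ 2) := by
      intro ω
      set s := ∑ m ∈ Finset.range t, x m ω
      have h1 : ‖s‖ ^ 2 ≤ t * ∑ m ∈ Finset.range t, ‖x m ω‖ ^ 2 := by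
        have e1 : ‖s‖ ^ 2 ≤ (∑ m ∈ Finset.range t, ‖x m ω‖) ^ 2 := by
          gcongr
          exact norm_sum_le _ _
        refine e1.trans (sq_sum_le_card_mul_sum_sq.trans_eq ?_)
        rw [Finset.card_range]
      refine (b.le_opNorm₂ (A s) (A s)).trans ?_
      calc ‖b‖ * ‖A s‖ * ‖A s‖ = ‖b‖ * ‖A s‖ ^ 2 := by ring
        _ ≤ ‖b‖ * (‖A‖ * ‖s‖) ^ 2 := by
          gcongr
          exact A.le_opNorm s
        _ = ‖b‖ * ‖A‖ ^ 2 * ‖s‖ ^ 2 := by ring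
        _ ≤ _ := by gcongr
    have i2 : ∀ m, Integrable (fun ω => ‖x m ω‖ ^ 2) P := fun m =>
      hx.integrable_comp hg (ψ := fun u => ‖u‖ ^ 2) (by fun_prop) m
    have h1 := norm_integral_le_of_norm_le
      (((integrable_finsetSum _ fun m _ => i2 m).const_mul _).const_mul _)
      (Filter.Eventually.of_forall hpt)
    rw [integral_const_mul, integral_const_mul, integral_finsetSum _ fun m _ => i2 m,
      Real.norm_eq_abs] at h1
    set I := ∫ ω, b (A (∑ m ∈ Finset.range t, x m ω)) (A (∑ m ∈ Finset.range t, x m ω)) ∂P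
    have h2 : ∑ m ∈ Finset.range t, ∫ ω, ‖x m ω‖ ^ 2 ∂P ≤ t * (R * η) := by
      refine (Finset.sum_le_sum fun m _ => hR m).trans_eq ?_
      simp
    have h3 : |(t : ℝ)⁻¹ * I| ≤ ‖b‖ * (‖A‖ ^ 2 * R) := by
      rw [abs_mul, abs_of_pos (inv_pos.2 ht0), inv_mul_le_iff₀ ht0]
      calc |I| ≤ ‖b‖ * ‖A‖ ^ 2 * (t * (t * (R * η))) := h1.trans (by gcongr)
        _ = t * (‖b‖ * (‖A‖ ^ 2 * R)) * (t * η) := by ring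
        _ ≤ t * (‖b‖ * (‖A‖ ^ 2 * R)) := mul_le_of_le_one_right (by positivity) htη.le
    calc |(t : ℝ)⁻¹ * I - Γ| ≤ |(t : ℝ)⁻¹ * I| + |Γ| := abs_sub _ _
      _ ≤ ‖b‖ * (‖A‖ ^ 2 * R) + ‖b‖ * D ^ 2 := add_le_add h3 (hΓle b)
      _ = ‖b‖ * (0 + 0 + 0 + (‖A‖ ^ 2 * R + D ^ 2)) * (0 + 1) := by ring
      _ ≤ _ := by gcongr <;> positivity
  · push Not at htη
    have hρM : √ρ ≤ √(1 + M) := by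
      apply Real.sqrt_le_sqrt
      have : 1 / (t * η) ≤ 1 := by
        rw [div_le_iff₀ (by positivity)]
        linarith
      linarith
    set S := noiseSum g ν x Z t with hS
    set Y := remainder g ν A η x t with hY
    have mS : MemLp S 2 P := hx.memLp_pair hg (ψ := fun q => q.2) continuous_snd t
    have mY : MemLp Y 2 P := hx.memLp_remainder hg t
    have iS := (memLp_two_iff_integrable_sq_norm mS.1).1 mS
    have iY := (memLp_two_iff_integrable_sq_norm mY.1).1 mY
    have hYle : ∫ ω, ‖Y ω‖ ^ 2 ∂P ≤ t * (C₄ * ρ) := by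
      refine (hx.integral_remainder_sq_le hg hη hR hR₄ t).trans ?_
      have e1 : t * (C₄ * ρ) = 8 * R / η + 2 * t ^ 2 * Q ^ 2 * R₄ * η ^ 2
          + (8 * R * (t ^ 2 * η ^ 2) + 2 * Q ^ 2 * R₄ / η) := by
        rw [hC₄, hρ]
        field_simp
        ring
      rw [e1]
      have : 0 ≤ 8 * R * (t ^ 2 * η ^ 2) + 2 * Q ^ 2 * R₄ / η := by positivity
      linarith
    have hSle : ∫ ω, ‖S ω‖ ^ 2 ∂P ≤ t * (D ^ 2 + C₂) := by
      have hin : ∀ u : E, (innerSL ℝ : E →L[ℝ] E →L[ℝ] ℝ) u u = ‖u‖ ^ 2 :=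
        real_inner_self_eq_norm_sq
      have h1 := hx.abs_integral_bilin_noiseSum_sub_le hg hD hL hη hη1 hR (innerSL ℝ) t
      have h2 := hΓle (innerSL ℝ)
      have hn : ‖(innerSL ℝ : E →L[ℝ] E →L[ℝ] ℝ)‖ ≤ 1 := norm_innerSL_le ℝ
      simp only [hin] at h1 h2
      rw [← hS, ← hC₂] at h1
      have h3 : √η ≤ 1 := Real.sqrt_le_one.2 hη1
      have h4 : ‖(innerSL ℝ : E →L[ℝ] E →L[ℝ] ℝ)‖ * (C₂ * √η) ≤ 1 * (C₂ * 1) := by gcongr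
      have h5 : ‖(innerSL ℝ : E →L[ℝ] E →L[ℝ] ℝ)‖ * D ^ 2 ≤ 1 * D ^ 2 := by gcongr
      have h6 := (le_abs_self _).trans h1
      have h7 := (le_abs_self _).trans h2
      have h8 := mul_le_mul_of_nonneg_left h4 ht0.le
      have h9 := mul_le_mul_of_nonneg_left (h7.trans h5) ht0.le
      linarith
    have hcov := hx.abs_integral_bilin_noiseSum_sub_le hg hD hL hη hη1 hR b t
    rw [← hS, ← hC₂, ← hΓ] at hcov
    simp_rw [hx.map_sum_eq (g := g) (ν := ν) (A := A) hη.ne' t, ← hS, ← hY]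
    -- the cross terms are split by `2 ‖Y‖ ‖S‖ ≤ ‖Y‖² / √ρ + √ρ ‖S‖²`
    have hpt : ∀ ω, ‖b (Y ω - S ω) (Y ω - S ω) - b (S ω) (S ω)‖
        ≤ ‖b‖ * ((1 + (√ρ)⁻¹) * ‖Y ω‖ ^ 2 + √ρ * ‖S ω‖ ^ 2) := by
      intro ω
      have h1 := abs_bilin_sub_le b (Y ω - S ω) (-S ω)
      simp only [sub_neg_eq_add, sub_add_cancel, map_neg, neg_apply, neg_neg, norm_neg] at h1
      refine h1.trans (mul_le_mul_of_nonneg_left ?_ (norm_nonneg b))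
      have h2 : (√ρ)⁻¹ * ‖Y ω‖ ^ 2 + √ρ * ‖S ω‖ ^ 2 - 2 * ‖Y ω‖ * ‖S ω‖
          = (√ρ)⁻¹ * (‖Y ω‖ - √ρ * ‖S ω‖) ^ 2 := by
        field_simp
        ring
      have h3 : 0 ≤ (√ρ)⁻¹ * (‖Y ω‖ - √ρ * ‖S ω‖) ^ 2 := by positivity
      linarith
    have j1 : Integrable (fun ω => b (Y ω - S ω) (Y ω - S ω)) P :=
      integrable_bilin_self (mY.sub mS) b
    have j2 := integrable_bilin_self mS b
    have hdiff : |(∫ ω, b (Y ω - S ω) (Y ω - S ω) ∂P) - ∫ ω, b (S ω) (S ω) ∂P|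
        ≤ t * (‖b‖ * ((C₄ * (1 + √(1 + M)) + (D ^ 2 + C₂)) * √ρ)) := by
      have h1 := norm_integral_le_of_norm_le
        (((iY.const_mul (1 + (√ρ)⁻¹)).add (iS.const_mul (√ρ))).const_mul ‖b‖)
        (Filter.Eventually.of_forall hpt)
      simp only [Pi.add_apply] at h1
      rw [integral_sub j1 j2, Real.norm_eq_abs, integral_const_mul,
        integral_add (iY.const_mul _) (iS.const_mul _), integral_const_mul,
        integral_const_mul] at h1
      refine h1.trans ?_
      have h2 : (1 + (√ρ)⁻¹) * ∫ ω, ‖Y ω‖ ^ 2 ∂P ≤ (1 + (√ρ)⁻¹) * (t * (C₄ * ρ)) := by gcongr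
      have h3 : √ρ * ∫ ω, ‖S ω‖ ^ 2 ∂P ≤ √ρ * (t * (D ^ 2 + C₂)) := by gcongr
      have h4 : (1 + (√ρ)⁻¹) * (t * (C₄ * ρ)) = t * (C₄ * √ρ * (√ρ + 1)) := by
        nth_rw 2 [← hss]
        field_simp
      have h5 : t * (C₄ * √ρ * (√ρ + 1)) ≤ t * (C₄ * √ρ * (√(1 + M) + 1)) := by gcongr
      calc ‖b‖ * ((1 + (√ρ)⁻¹) * ∫ ω, ‖Y ω‖ ^ 2 ∂P + √ρ * ∫ ω, ‖S ω‖ ^ 2 ∂P)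
          ≤ ‖b‖ * (t * (C₄ * √ρ * (√(1 + M) + 1)) + √ρ * (t * (D ^ 2 + C₂))) := by
            refine mul_le_mul_of_nonneg_left ?_ (norm_nonneg b)
            linarith
        _ = _ := by ring
    have hfin : |(∫ ω, b (Y ω - S ω) (Y ω - S ω) ∂P) - t * Γ|
        ≤ t * (‖b‖ * ((C₄ * (1 + √(1 + M)) + (D ^ 2 + C₂)) * √ρ + C₂ * √η)) := by
      have := abs_sub_le (∫ ω, b (Y ω - S ω) (Y ω - S ω) ∂P) (∫ ω, b (S ω) (S ω) ∂P) (t * Γ)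
      linarith
    set I := ∫ ω, b (Y ω - S ω) (Y ω - S ω) ∂P
    have h1 : (t : ℝ)⁻¹ * I - Γ = (t : ℝ)⁻¹ * (I - t * Γ) := by field_simp
    rw [h1, abs_mul, abs_of_pos (inv_pos.2 ht0), inv_mul_le_iff₀ ht0]
    refine hfin.trans ?_
    rw [mul_assoc ‖b‖]
    refine mul_le_mul_of_nonneg_left (mul_le_mul_of_nonneg_left ?_ (norm_nonneg b)) ht0.le
    have hsη : 0 ≤ √η := Real.sqrt_nonneg η
    have k1 : 0 ≤ (D ^ 2 + C₂ + C₄ * (1 + √(1 + M)) + (‖A‖ ^ 2 * R + D ^ 2)) * √η := by positivity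
    have k2 : 0 ≤ (C₂ + (‖A‖ ^ 2 * R + D ^ 2)) * √ρ := by positivity
    linarith

end IsChain

end Chain

/-! ### The logistic function -/

lemma abs_sigmoid_sub_le (a b : ℝ) : |Real.sigmoid b - Real.sigmoid a| ≤ |b - a| := by
  have h := convex_univ.norm_image_sub_le_of_norm_hasDerivWithin_le (C := 1) (x := a) (y := b)
    (f := Real.sigmoid) (f' := fun x => Real.sigmoid x * (1 - Real.sigmoid x))
    (fun x _ => (Real.hasDerivAt_sigmoid x).hasDerivWithinAt) (fun x _ => ?_)
    (Set.mem_univ _) (Set.mem_univ _)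
  · simpa using h
  · rw [Real.norm_eq_abs, abs_le]
    constructor <;> nlinarith [Real.sigmoid_pos x, Real.sigmoid_lt_one x]

/-- The derivative of the sigmoid is Lipschitz with constant one. -/
lemma abs_sigmoid_taylor_le (a b : ℝ) :
    |Real.sigmoid b - Real.sigmoid a - Real.sigmoid a * (1 - Real.sigmoid a) * (b - a)|
      ≤ (b - a) ^ 2 := by
  set d := Real.sigmoid a * (1 - Real.sigmoid a) with hd
  have hder : ∀ x, HasDerivAt (fun x => Real.sigmoid x - d * x)
      (Real.sigmoid x * (1 - Real.sigmoid x) - d * 1) x := fun x =>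
    (Real.hasDerivAt_sigmoid x).sub ((hasDerivAt_id x).const_mul d)
  have h := (convex_uIcc a b).norm_image_sub_le_of_norm_hasDerivWithin_le (C := |b - a|)
    (x := a) (y := b) (fun x _ => (hder x).hasDerivWithinAt) (fun x hx => ?_)
    Set.left_mem_uIcc Set.right_mem_uIcc
  · rw [Real.norm_eq_abs, Real.norm_eq_abs, ← sq, sq_abs] at h
    convert h using 2
    ring
  · have h1 : |x - a| ≤ |b - a| := Set.abs_sub_left_of_mem_uIcc hx
    have h2 : Real.sigmoid x * (1 - Real.sigmoid x) - d * 1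
        = (Real.sigmoid x - Real.sigmoid a) * (1 - Real.sigmoid x - Real.sigmoid a) := by
      rw [hd]
      ring
    rw [h2, Real.norm_eq_abs, abs_mul]
    have h3 : |1 - Real.sigmoid x - Real.sigmoid a| ≤ 1 := by
      rw [abs_le]
      constructor <;> linarith [Real.sigmoid_pos x, Real.sigmoid_lt_one x, Real.sigmoid_pos a,
        Real.sigmoid_lt_one a]
    calc |Real.sigmoid x - Real.sigmoid a| * |1 - Real.sigmoid x - Real.sigmoid a|
        ≤ |x - a| * 1 :=
          mul_le_mul (abs_sigmoid_sub_le a x) h3 (abs_nonneg _) (abs_nonneg _)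
      _ ≤ |b - a| := by linarith

lemma hasDerivAt_log_one_add_exp_neg (s : ℝ) :
    HasDerivAt (fun s => Real.log (1 + Real.exp (-s))) (-Real.sigmoid (-s)) s := by
  have h0 : (1 + Real.exp (-s)) ≠ 0 := by positivity
  have h := (((hasDerivAt_id s).neg.exp).const_add 1).log h0
  refine h.congr_deriv ?_
  rw [← Real.sigmoid_mul_rexp_neg s, Real.sigmoid_def]
  simp only [Pi.neg_apply, id, mul_neg, mul_one]
  field_simp

lemma abs_log_one_add_exp_neg_sub_le (a b : ℝ) :
    |Real.log (1 + Real.exp (-b)) - Real.log (1 + Real.exp (-a))| ≤ |b - a| := by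
  have h := convex_univ.norm_image_sub_le_of_norm_hasDerivWithin_le (C := 1) (x := a) (y := b)
    (fun x _ => (hasDerivAt_log_one_add_exp_neg x).hasDerivWithinAt) (fun x _ => ?_)
    (Set.mem_univ _) (Set.mem_univ _)
  · simpa using h
  · rw [norm_neg, Real.norm_eq_abs, abs_le]
    constructor <;> linarith [Real.sigmoid_pos (-x), Real.sigmoid_lt_one (-x)]

/-- The logistic loss lies above its tangents: with `w = sigmoid (-a)` this is the convexity
inequality `exp (-w (b - a)) ≤ (1 - w) + w exp (-(b - a))`. -/
lemma log_one_add_exp_neg_tangent_le (a b : ℝ) :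
    Real.log (1 + Real.exp (-a)) - Real.sigmoid (-a) * (b - a)
      ≤ Real.log (1 + Real.exp (-b)) := by
  set w := Real.sigmoid (-a) with hw
  have hw0 : 0 ≤ w := Real.sigmoid_nonneg _
  have hw1 : w ≤ 1 := Real.sigmoid_le_one _
  have hpos : 0 < 1 + Real.exp (-a) := by positivity
  have h1 := convexOn_exp.2 (Set.mem_univ (0 : ℝ)) (Set.mem_univ (-(b - a)))
    (sub_nonneg.2 hw1) hw0 (by ring)
  simp only [smul_eq_mul, mul_zero, zero_add, Real.exp_zero, mul_one] at h1
  have h2 : (1 + Real.exp (-a)) * w = Real.exp (-a) := by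
    rw [hw, ← Real.sigmoid_mul_rexp_neg a, Real.sigmoid_def]
    field_simp
  have h3 : (1 + Real.exp (-a)) * (1 - w + w * Real.exp (-(b - a))) = 1 + Real.exp (-b) := by
    have h4 : Real.exp (-b) = Real.exp (-a) * Real.exp (-(b - a)) := by
      rw [← Real.exp_add]
      congr 1
      ring
    rw [h4]
    linear_combination (Real.exp (-(b - a)) - 1) * h2
  rw [← h3, Real.log_mul hpos.ne' (by linarith [Real.exp_pos (w * -(b - a))]), sub_eq_add_neg]
  gcongr
  rw [Real.le_log_iff_exp_le (by linarith [Real.exp_pos (w * -(b - a))])]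
  rwa [show -(w * (b - a)) = w * -(b - a) by ring]

/-! ### Gradient and Hessian of the logistic risk -/

section Risk

variable {n p : ℕ} {X : Fin n → EuclideanSpace ℝ (Fin p)} {y : Fin n → ℝ}

/-- The second derivative of the loss of sample `i`, as a linear map. -/
noncomputable def lossHess (X : Fin n → EuclideanSpace ℝ (Fin p)) (y : Fin n → ℝ) (i : Fin n)
    (θ : EuclideanSpace ℝ (Fin p)) : EuclideanSpace ℝ (Fin p) →L[ℝ] EuclideanSpace ℝ (Fin p) :=
  (Real.sigmoid (-(y i * inner ℝ θ (X i))) * (1 - Real.sigmoid (-(y i * inner ℝ θ (X i))))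
    * y i ^ 2) • (innerSL ℝ (X i)).smulRight (X i)

lemma hasFDerivAt_margin (i : Fin n) (θ : EuclideanSpace ℝ (Fin p)) :
    HasFDerivAt (fun θ => y i * inner ℝ θ (X i)) (y i • innerSL ℝ (X i)) θ := by
  have h := (innerSL ℝ (X i)).hasFDerivAt (x := θ) |>.const_mul (y i)
  simpa only [coe_innerSL_apply, real_inner_comm] using h

lemma hasGradientAt_loss (i : Fin n) (θ : EuclideanSpace ℝ (Fin p)) :
    HasGradientAt (loss X y i)
      (-(Real.sigmoid (-(y i * inner ℝ θ (X i))) * y i) • X i) θ := by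
  rw [hasGradientAt_iff_hasFDerivAt]
  refine ((hasDerivAt_log_one_add_exp_neg _).comp_hasFDerivAt θ
    (hasFDerivAt_margin (X := X) (y := y) i θ)).congr_fderiv ?_
  ext v
  simp
  ring

lemma gradient_loss (i : Fin n) (θ : EuclideanSpace ℝ (Fin p)) :
    gradient (loss X y i) θ = -(Real.sigmoid (-(y i * inner ℝ θ (X i))) * y i) • X i :=
  (hasGradientAt_loss i θ).gradient

lemma continuous_loss (i : Fin n) : Continuous (loss X y i) :=
  continuous_iff_continuousAt.2 fun θ => (hasGradientAt_loss i θ).differentiableAt.continuousAt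

lemma hasFDerivAt_gradient_loss (i : Fin n) (θ : EuclideanSpace ℝ (Fin p)) :
    HasFDerivAt (gradient (loss X y i)) (lossHess X y i θ) θ := by
  have h := ((((Real.hasDerivAt_sigmoid _).comp_hasFDerivAt θ
    (hasFDerivAt_margin (X := X) (y := y) i θ).neg).mul_const (y i)).neg).smul_const (X i)
  refine (h.congr_of_eventuallyEq
    (Filter.Eventually.of_forall fun θ => gradient_loss i θ)).congr_fderiv ?_
  ext v
  simp [lossHess]
  ring

lemma continuous_gradient_loss (i : Fin n) : Continuous (gradient (loss X y i)) :=
  continuous_iff_continuousAt.2 fun θ => (hasFDerivAt_gradient_loss i θ).continuousAt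

lemma hasGradientAt_risk (θ : EuclideanSpace ℝ (Fin p)) :
    HasGradientAt (risk X y) ((1 / (n : ℝ)) • ∑ i, gradient (loss X y i) θ) θ := by
  rw [hasGradientAt_iff_hasFDerivAt, map_smul, map_sum]
  refine (HasFDerivAt.fun_sum fun i _ => ?_).const_mul _
  rw [toDual_gradient]
  exact (hasGradientAt_loss i θ).differentiableAt.hasFDerivAt

lemma gradient_risk (θ : EuclideanSpace ℝ (Fin p)) :
    gradient (risk X y) θ = (1 / (n : ℝ)) • ∑ i, gradient (loss X y i) θ :=
  (hasGradientAt_risk θ).gradient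

/-- The second derivative of the empirical risk, as a linear map. -/
noncomputable def riskHess (X : Fin n → EuclideanSpace ℝ (Fin p)) (y : Fin n → ℝ)
    (θ : EuclideanSpace ℝ (Fin p)) : EuclideanSpace ℝ (Fin p) →L[ℝ] EuclideanSpace ℝ (Fin p) :=
  (1 / (n : ℝ)) • ∑ i, lossHess X y i θ

lemma hasFDerivAt_gradient_risk (θ : EuclideanSpace ℝ (Fin p)) :
    HasFDerivAt (gradient (risk X y)) (riskHess X y θ) θ := by
  rw [show gradient (risk X y) = fun θ => (1 / (n : ℝ)) • ∑ i, gradient (loss X y i) θ from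
    funext gradient_risk]
  exact (HasFDerivAt.fun_sum fun i _ => hasFDerivAt_gradient_loss i θ).const_smul (1 / (n : ℝ))

lemma gradient_objective (c : ℝ) (θ : EuclideanSpace ℝ (Fin p)) :
    gradient (objective X y c) θ = (c + risk X y θ) • gradient (risk X y) θ := by
  refine HasGradientAt.gradient ?_
  rw [hasGradientAt_iff_hasFDerivAt, map_smul, gradient_risk]
  refine (((hasGradientAt_iff_hasFDerivAt.1 (hasGradientAt_risk θ)).const_add c).pow 2
    |>.const_mul (1 / 2)).congr_fderiv ?_
  ext v
  simp
  ring

/-- At a critical point of the risk, the second derivative of the objective is a multiple of the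
second derivative of the risk. -/
lemma hasFDerivAt_gradient_objective (c : ℝ) {θ : EuclideanSpace ℝ (Fin p)}
    (hθ : gradient (risk X y) θ = 0) :
    HasFDerivAt (gradient (objective X y c)) ((c + risk X y θ) • riskHess X y θ) θ := by
  rw [show gradient (objective X y c) = fun θ => (c + risk X y θ) • gradient (risk X y) θ from
    funext (gradient_objective c)]
  refine (((hasGradientAt_iff_hasFDerivAt.1 (hasGradientAt_risk θ)).const_add c).smul
    (hasFDerivAt_gradient_risk θ)).congr_fderiv ?_
  ext v
  simp [hθ]

lemma gradient_risk_eq_zero {θ : EuclideanSpace ℝ (Fin p)}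
    (hmin : IsMinOn (risk X y) Set.univ θ) : gradient (risk X y) θ = 0 := by
  have h := (hmin.isLocalMin Filter.univ_mem).fderiv_eq_zero
  rw [gradient, h, map_zero]

lemma toEuclideanCLM_hessian {F : EuclideanSpace ℝ (Fin p) → ℝ} {θ : EuclideanSpace ℝ (Fin p)}
    {T : EuclideanSpace ℝ (Fin p) →L[ℝ] EuclideanSpace ℝ (Fin p)}
    (h : HasFDerivAt (gradient F) T θ) :
    Matrix.toEuclideanCLM (n := Fin p) (𝕜 := ℝ) (hessian F θ) = T := by
  refine ContinuousLinearMap.coe_injective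
    ((EuclideanSpace.basisFun (Fin p) ℝ).toBasis.ext fun j => ?_)
  ext i
  simp [hessian, h.fderiv, Matrix.ofLp_toEuclideanCLM, Matrix.mulVec_single]

/-! ### Global bounds for the logistic losses -/

/-- A common bound for the norms of the samples. -/
noncomputable def sampleBound (X : Fin n → EuclideanSpace ℝ (Fin p)) : ℝ := ∑ i, ‖X i‖

lemma sampleBound_nonneg : 0 ≤ sampleBound X := Finset.sum_nonneg fun _ _ => norm_nonneg _

lemma norm_le_sampleBound (i : Fin n) : ‖X i‖ ≤ sampleBound X :=
  Finset.single_le_sum (f := fun i => ‖X i‖) (fun _ _ => norm_nonneg _) (Finset.mem_univ i)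

lemma loss_nonneg (i : Fin n) (θ : EuclideanSpace ℝ (Fin p)) : 0 ≤ loss X y i θ :=
  Real.log_nonneg (by linarith [Real.exp_pos (-(y i * inner ℝ θ (X i)))])

lemma abs_margin_add_sub_le {i : Fin n} (hy : |y i| = 1) (θ x : EuclideanSpace ℝ (Fin p)) :
    |y i * inner ℝ (θ + x) (X i) - y i * inner ℝ θ (X i)| ≤ ‖X i‖ * ‖x‖ := by
  rw [inner_add_left, mul_add, add_sub_cancel_left, abs_mul, hy, one_mul, mul_comm]
  exact abs_real_inner_le_norm _ _

lemma abs_loss_sub_le {i : Fin n} (hy : |y i| = 1) (θ x : EuclideanSpace ℝ (Fin p)) :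
    |loss X y i (θ + x) - loss X y i θ| ≤ sampleBound X * ‖x‖ := by
  refine (abs_log_one_add_exp_neg_sub_le _ _).trans ((abs_margin_add_sub_le hy θ x).trans ?_)
  gcongr
  exact norm_le_sampleBound i

lemma norm_gradient_loss_le {i : Fin n} (hy : |y i| = 1) (θ : EuclideanSpace ℝ (Fin p)) :
    ‖gradient (loss X y i) θ‖ ≤ sampleBound X := by
  rw [gradient_loss, norm_smul, norm_neg, norm_mul, Real.norm_eq_abs, Real.norm_eq_abs, hy,
    mul_one, abs_of_pos (Real.sigmoid_pos _)]
  exact (mul_le_of_le_one_left (norm_nonneg _) (Real.sigmoid_le_one _)).trans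
    (norm_le_sampleBound i)

lemma norm_gradient_loss_sub_le {i : Fin n} (hy : |y i| = 1)
    (θ x : EuclideanSpace ℝ (Fin p)) :
    ‖gradient (loss X y i) (θ + x) - gradient (loss X y i) θ‖ ≤ sampleBound X ^ 2 * ‖x‖ := by
  rw [gradient_loss, gradient_loss, ← sub_smul, norm_smul, Real.norm_eq_abs]
  have h1 : |-(Real.sigmoid (-(y i * inner ℝ (θ + x) (X i))) * y i)
      - -(Real.sigmoid (-(y i * inner ℝ θ (X i))) * y i)| ≤ ‖X i‖ * ‖x‖ := by
    have h2 := abs_sigmoid_sub_le (-(y i * inner ℝ (θ + x) (X i))) (-(y i * inner ℝ θ (X i)))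
    rw [← neg_sub', abs_neg, ← sub_mul, abs_mul, hy, mul_one, abs_sub_comm]
    refine h2.trans ?_
    rw [neg_sub_neg]
    exact abs_margin_add_sub_le hy θ x
  have h3 := norm_le_sampleBound (X := X) i
  have h4 := sampleBound_nonneg (X := X)
  calc _ ≤ ‖X i‖ * ‖x‖ * ‖X i‖ := by gcongr
    _ ≤ sampleBound X * ‖x‖ * sampleBound X := by gcongr
    _ = _ := by ring

lemma norm_gradient_loss_taylor_le {i : Fin n} (hy : |y i| = 1)
    (θ x : EuclideanSpace ℝ (Fin p)) :
    ‖gradient (loss X y i) (θ + x) - gradient (loss X y i) θ - lossHess X y i θ x‖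
      ≤ sampleBound X ^ 3 * ‖x‖ ^ 2 := by
  set a := -(y i * inner ℝ θ (X i)) with ha
  set b := -(y i * inner ℝ (θ + x) (X i)) with hb
  have hba : b - a = -(y i * inner ℝ x (X i)) := by
    rw [ha, hb, inner_add_left]
    ring
  have h1 : gradient (loss X y i) (θ + x) - gradient (loss X y i) θ - lossHess X y i θ x
      = -((Real.sigmoid b - Real.sigmoid a
        - Real.sigmoid a * (1 - Real.sigmoid a) * (b - a)) * y i) • X i := by
    rw [gradient_loss, gradient_loss, hba]
    simp only [lossHess, smul_apply, ContinuousLinearMap.smulRight_apply,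
      coe_innerSL_apply, smul_smul, ← sub_smul, real_inner_comm x (X i),
      ← ha, ← hb]
    congr 1
    ring
  have h2 : (b - a) ^ 2 ≤ (‖X i‖ * ‖x‖) ^ 2 := by
    rw [← sq_abs (b - a), hba, abs_neg, abs_mul, hy, one_mul, mul_comm]
    gcongr
    exact abs_real_inner_le_norm _ _
  have h3 := norm_le_sampleBound (X := X) i
  have h4 := sampleBound_nonneg (X := X)
  rw [h1, norm_smul, norm_neg, norm_mul, Real.norm_eq_abs, Real.norm_eq_abs, hy, mul_one]
  calc _ ≤ (‖X i‖ * ‖x‖) ^ 2 * ‖X i‖ := by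
        gcongr
        exact (abs_sigmoid_taylor_le a b).trans h2
    _ ≤ (sampleBound X * ‖x‖) ^ 2 * sampleBound X := by gcongr
    _ = _ := by ring

lemma loss_tangent_le (i : Fin n) (θ θ' : EuclideanSpace ℝ (Fin p)) :
    loss X y i θ + inner ℝ (gradient (loss X y i) θ) (θ' - θ) ≤ loss X y i θ' := by
  refine le_of_eq_of_le ?_ (log_one_add_exp_neg_tangent_le (y i * inner ℝ θ (X i))
    (y i * inner ℝ θ' (X i)))
  rw [gradient_loss, inner_smul_left, real_inner_comm (θ' - θ) (X i), inner_sub_left, loss]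
  simp only [conj_trivial]
  ring

end Risk

/-! ### Moments of the mini-batches -/

section Batch

variable {n S : ℕ}

lemma integral_uniformOn {V : Type*} [Fintype V] [MeasurableSpace V] [MeasurableSingletonClass V]
    (D : Set V) [DecidablePred (· ∈ D)] (φ : V → ℝ) :
    ∫ v, φ v ∂(uniformOn D) = (Measure.count D).toReal⁻¹ * ∑ v, if v ∈ D then φ v else 0 := by
  rw [uniformOn, ProbabilityTheory.cond, integral_smul_measure,
    ← integral_indicator D.toFinite.measurableSet, integral_fintype Integrable.of_finite]
  simp [ENNReal.toReal_inv, Set.indicator_apply]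

/-- The uniform distribution on `D` is invariant under the bijections that preserve `D`. -/
lemma integral_uniformOn_comp_equiv {V : Type*} [Fintype V] [MeasurableSpace V]
    [MeasurableSingletonClass V] {D : Set V} (e : V ≃ V) (he : ∀ v, e v ∈ D ↔ v ∈ D) (φ : V → ℝ) :
    ∫ v, φ (e v) ∂(uniformOn D) = ∫ v, φ v ∂(uniformOn D) := by
  classical
  rw [integral_uniformOn, integral_uniformOn, ← Equiv.sum_comp e (fun v => if v ∈ D then φ v else 0)]
  simp only [he]

lemma Scheme.isProbabilityMeasure_uniformOn_draws {scheme : Scheme}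
    (hS : scheme.Admissible n S) (hn : 0 < n) :
    IsProbabilityMeasure (uniformOn (scheme.draws n S)) := by
  refine isProbabilityMeasure_uniformOn (Set.toFinite _) ?_
  cases scheme with
  | withReplacement => exact ⟨fun _ => ⟨0, hn⟩, Set.mem_univ _⟩
  | withoutReplacement => exact ⟨Fin.castLE hS.2, Fin.castLE_injective hS.2⟩

/-- The probability that the draws `l` and `l'` yield `a` and `b`. -/
noncomputable def pairProb (σ : Measure (Fin S → Fin n)) (l l' : Fin S) (a b : Fin n) : ℝ :=
  ∫ v, (if v l = a ∧ v l' = b then 1 else 0) ∂σ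

variable {σ : Measure (Fin S → Fin n)} [IsProbabilityMeasure σ]

lemma integral_pair_eq_sum (l l' : Fin S) (φ : Fin n → Fin n → ℝ) :
    ∫ v, φ (v l) (v l') ∂σ = ∑ a, ∑ b, φ a b * pairProb σ l l' a b := by
  have h : ∀ v : Fin S → Fin n, φ (v l) (v l')
      = ∑ a, ∑ b, φ a b * (if v l = a ∧ v l' = b then 1 else 0) := by
    intro v
    rw [Finset.sum_eq_single (v l), Finset.sum_eq_single (v l')]
    · simp
    · intro b _ hb
      simp [hb.symm]
    · simp
    · intro a _ ha
      simp [ha.symm]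
    · simp
  simp_rw [h, pairProb, ← integral_const_mul]
  rw [integral_finsetSum _ fun _ _ => Integrable.of_finite]
  exact Finset.sum_congr rfl fun a _ => integral_finsetSum _ fun _ _ => Integrable.of_finite

lemma sum_pairProb (l l' : Fin S) : ∑ a, ∑ b, pairProb σ l l' a b = 1 := by
  have h := integral_pair_eq_sum (σ := σ) l l' (fun _ _ => 1)
  simpa using h.symm

omit [IsProbabilityMeasure σ] in
lemma pairProb_self_of_ne (l : Fin S) {a b : Fin n} (hab : a ≠ b) : pairProb σ l l a b = 0 := by
  have h : ∀ v : Fin S → Fin n, ¬(v l = a ∧ v l = b) := fun v hv => hab (hv.1.symm.trans hv.2)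
  simp [pairProb, h]

lemma pairProb_eq_of_equiv {D : Set (Fin S → Fin n)} {l l' : Fin S} {a b a' b' : Fin n}
    (τ : Fin S → Equiv.Perm (Fin n)) (hD : ∀ v, (fun k => τ k (v k)) ∈ D ↔ v ∈ D)
    (ha : τ l a = a') (hb : τ l' b = b') :
    pairProb (uniformOn D) l l' a b = pairProb (uniformOn D) l l' a' b' := by
  have h := integral_uniformOn_comp_equiv (Equiv.piCongrRight τ) hD
    (fun v => if v l = a' ∧ v l' = b' then 1 else 0)
  rw [pairProb, pairProb, ← h]
  subst ha hb
  simp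

/-- Postcomposition with a permutation preserves both sets of draws. -/
lemma Scheme.comp_perm_mem_draws (scheme : Scheme) (τ : Equiv.Perm (Fin n)) (v : Fin S → Fin n) :
    (fun k => τ (v k)) ∈ scheme.draws n S ↔ v ∈ scheme.draws n S := by
  cases scheme with
  | withReplacement => simp [Scheme.draws]
  | withoutReplacement => exact τ.injective.of_comp_iff v

/-- Every single draw is uniform. -/
lemma integral_draw {scheme : Scheme} (hS : scheme.Admissible n S) (hn : 0 < n) (l : Fin S)
    (h : Fin n → ℝ) :
    ∫ v, h (v l) ∂(uniformOn (scheme.draws n S)) = (1 / (n : ℝ)) * ∑ i, h i := by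
  have := Scheme.isProbabilityMeasure_uniformOn_draws hS hn
  have hn0 : (n : ℝ) ≠ 0 := by exact_mod_cast hn.ne'
  set q := fun a => pairProb (uniformOn (scheme.draws n S)) l l a a with hq
  have hdiag : ∀ φ : Fin n → ℝ, ∑ a, ∑ b, φ a * pairProb (uniformOn (scheme.draws n S)) l l a b
      = ∑ a, φ a * q a := fun φ => by
    refine Finset.sum_congr rfl fun a _ => ?_
    rw [Finset.sum_eq_single a (fun b _ hb => by rw [pairProb_self_of_ne l hb.symm, mul_zero])
      (by simp)]
  have hconst : ∀ a, q a = q ⟨0, hn⟩ := fun a =>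
    pairProb_eq_of_equiv (fun _ => Equiv.swap a ⟨0, hn⟩)
      (fun v => scheme.comp_perm_mem_draws _ v) (Equiv.swap_apply_left _ _)
      (Equiv.swap_apply_left _ _)
  have hsum : (n : ℝ) * q ⟨0, hn⟩ = 1 := by
    have h1 := sum_pairProb (σ := uniformOn (scheme.draws n S)) l l
    have h2 := hdiag fun _ => 1
    simp only [one_mul] at h2
    rw [h2, Finset.sum_congr rfl fun a _ => hconst a] at h1
    simpa using h1
  rw [integral_pair_eq_sum l l (fun a _ => h a), hdiag, Finset.sum_congr rfl fun a _ =>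
    show h a * q a = q ⟨0, hn⟩ * h a by rw [hconst a, mul_comm], ← Finset.mul_sum]
  congr 1
  field_simp
  linarith

/-- Different draws with replacement are independent. -/
lemma integral_draw_mul_draw_withReplacement (hn : 0 < n) {l l' : Fin S} (hl : l ≠ l')
    (h h' : Fin n → ℝ) :
    ∫ v, h (v l) * h' (v l') ∂(uniformOn (Scheme.withReplacement.draws n S))
      = ((1 / (n : ℝ)) * ∑ i, h i) * ((1 / (n : ℝ)) * ∑ i, h' i) := by
  have hS : Scheme.withReplacement.Admissible n S := Fin.pos l
  have := Scheme.isProbabilityMeasure_uniformOn_draws hS hn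
  have hn0 : (n : ℝ) ≠ 0 := by exact_mod_cast hn.ne'
  set i₀ : Fin n := ⟨0, hn⟩
  set q := pairProb (uniformOn (Scheme.withReplacement.draws n S)) l l' with hq
  have hconst : ∀ a b, q a b = q i₀ i₀ := fun a b =>
    pairProb_eq_of_equiv (fun k => if k = l then Equiv.swap a i₀ else Equiv.swap b i₀)
      (fun v => by simp [Scheme.draws]) (by simp) (by simp [hl.symm])
  have hsum : (n : ℝ) * (n * q i₀ i₀) = 1 := by
    have h1 := sum_pairProb (σ := uniformOn (Scheme.withReplacement.draws n S)) l l'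
    rw [← hq] at h1
    simp_rw [hconst] at h1
    simpa using h1
  have hval : q i₀ i₀ = (1 / (n : ℝ)) * (1 / n) := by
    field_simp
    linarith
  rw [integral_pair_eq_sum l l' (fun a b => h a * h' b), ← hq]
  simp_rw [hconst, hval, Finset.mul_sum, Finset.sum_mul]
  refine Finset.sum_comm.trans (Finset.sum_congr rfl fun a _ => Finset.sum_congr rfl fun b _ => ?_)
  ring

/-- Two different draws without replacement are uniform on the pairs of distinct indices. -/
lemma integral_draw_mul_draw_withoutReplacement (hS : S ≤ n) {l l' : Fin S}
    (hl : l ≠ l') (h h' : Fin n → ℝ) :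
    ∫ v, h (v l) * h' (v l') ∂(uniformOn (Scheme.withoutReplacement.draws n S))
      = (((∑ i, h i) * ∑ i, h' i) - ∑ i, h i * h' i) / (n * ((n : ℝ) - 1)) := by
  have hS0 : 0 < S := Fin.pos l
  have hn : 0 < n := hS0.trans_le hS
  have hS1 : 1 < S := by
    have := l.2
    have := l'.2
    have : (l : ℕ) ≠ l' := fun h => hl (Fin.ext h)
    omega
  have hadm : Scheme.withoutReplacement.Admissible n S := ⟨hS0, hS⟩
  have := Scheme.isProbabilityMeasure_uniformOn_draws hadm hn
  have hn0 : (n : ℝ) ≠ 0 := by exact_mod_cast hn.ne'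
  have hn1 : (n : ℝ) - 1 ≠ 0 := by
    have : (1 : ℝ) < n := by exact_mod_cast hS1.trans_le hS
    linarith
  set q := pairProb (uniformOn (Scheme.withoutReplacement.draws n S)) l l' with hq
  have hdiag : ∀ a, q a a = 0 := by
    classical
    intro a
    rw [hq, pairProb, integral_uniformOn]
    refine mul_eq_zero_of_right _ (Finset.sum_eq_zero fun v _ => ?_)
    split_ifs with h1 h2
    · exact absurd (h1 (h2.1.trans h2.2.symm)) hl
    · rfl
    · rfl
  have hconst : ∀ a b b', a ≠ b → a ≠ b' → q a b = q a b' := fun a b b' hb hb' =>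
    pairProb_eq_of_equiv (fun _ => Equiv.swap b b')
      (fun v => Scheme.withoutReplacement.comp_perm_mem_draws _ v)
      (Equiv.swap_apply_of_ne_of_ne hb hb') (Equiv.swap_apply_left _ _)
  have hrow : ∀ a, ∑ b, q a b = 1 / (n : ℝ) := by
    intro a
    have h1 := integral_draw hadm hn l (fun i => if i = a then 1 else 0)
    rw [integral_pair_eq_sum l l' (fun i _ => if i = a then 1 else 0)] at h1
    simpa using h1
  have hval : ∀ a b, a ≠ b → q a b = 1 / (n * ((n : ℝ) - 1)) := by
    intro a b hab
    have h1 : ∑ b', q a b' = ∑ b' ∈ Finset.univ.erase a, q a b := by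
      rw [← Finset.add_sum_erase _ _ (Finset.mem_univ a), hdiag, zero_add]
      exact Finset.sum_congr rfl fun b' hb' => hconst a b' b (Finset.ne_of_mem_erase hb').symm hab
    rw [hrow, Finset.sum_const, Finset.card_erase_of_mem (Finset.mem_univ a), Finset.card_univ,
      Fintype.card_fin, nsmul_eq_mul, Nat.cast_pred hn] at h1
    field_simp at h1 ⊢
    linarith
  have hq' : ∀ a b, h a * h' b * q a b
      = (1 / (n * ((n : ℝ) - 1))) * (h a * h' b - if a = b then h a * h' b else 0) := by
    intro a b
    split_ifs with hab
    · rw [← hab, hdiag, sub_self, mul_zero, mul_zero]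
    · rw [hval a b hab, sub_zero, mul_comm]
  rw [integral_pair_eq_sum l l' (fun a b => h a * h' b), ← hq]
  simp_rw [hq', ← Finset.mul_sum, Finset.sum_sub_distrib, ← Finset.mul_sum]
  rw [← Finset.sum_mul]
  simp only [Finset.sum_ite_eq, Finset.mem_univ, if_true]
  ring

/-- Second moments of batch sums, from the moments of pairs of draws. -/
lemma integral_sum_mul_sum (h h' : Fin n → ℝ) {d o : ℝ}
    (hd : ∀ l, ∫ v, h (v l) * h' (v l) ∂σ = d)
    (ho : ∀ l l', l ≠ l' → ∫ v, h (v l) * h' (v l') ∂σ = o) :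
    ∫ v, (∑ l, h (v l)) * (∑ l, h' (v l)) ∂σ = S * d + S * ((S : ℝ) - 1) * o := by
  have h1 : ∀ l l', ∫ v, h (v l) * h' (v l') ∂σ = o + if l = l' then d - o else 0 := by
    intro l l'
    split_ifs with hl
    · rw [← hl, hd]
      ring
    · rw [ho l l' hl, add_zero]
  simp_rw [Finset.sum_mul_sum]
  rw [integral_finsetSum _ fun _ _ => Integrable.of_finite]
  have h2 : ∀ l, ∫ v, ∑ l', h (v l) * h' (v l') ∂σ = S * o + (d - o) := by
    intro l
    rw [integral_finsetSum _ fun _ _ => Integrable.of_finite]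
    simp [h1, Finset.sum_add_distrib]
  simp only [h2, Finset.sum_const, Finset.card_univ, Fintype.card_fin, nsmul_eq_mul]
  ring

variable {p : ℕ} {X : Fin n → EuclideanSpace ℝ (Fin p)} {y : Fin n → ℝ}

lemma psiBatch_eq (hS : 0 < S) (c : ℝ) (v : Fin S → Fin n) (θ : EuclideanSpace ℝ (Fin p)) :
    psiBatch X y c v θ = (1 / (S : ℝ)) * ∑ l, (c + loss X y (v l) θ) := by
  have : (S : ℝ) ≠ 0 := by exact_mod_cast hS.ne'
  rw [psiBatch, Finset.sum_add_distrib, mul_add]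
  simp only [Finset.sum_const, Finset.card_univ, Fintype.card_fin, nsmul_eq_mul]
  field_simp

lemma Scheme.Admissible.pos {scheme : Scheme} (hS : scheme.Admissible n S) : 0 < S := by
  cases scheme with
  | withReplacement => exact hS
  | withoutReplacement => exact hS.1

lemma add_risk_eq (hn : 0 < n) (c : ℝ) (θ : EuclideanSpace ℝ (Fin p)) :
    c + risk X y θ = (1 / (n : ℝ)) * ∑ i, (c + loss X y i θ) := by
  have : (n : ℝ) ≠ 0 := by exact_mod_cast hn.ne'
  rw [risk, Finset.sum_add_distrib, mul_add]
  simp only [Finset.sum_const, Finset.card_univ, Fintype.card_fin, nsmul_eq_mul]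
  field_simp

lemma integral_psiBatch {scheme : Scheme} (hn : 0 < n) (hS : scheme.Admissible n S) (c : ℝ)
    (θ : EuclideanSpace ℝ (Fin p)) :
    ∫ v, psiBatch X y c v θ ∂(uniformOn (scheme.draws n S)) = c + risk X y θ := by
  have : (S : ℝ) ≠ 0 := by exact_mod_cast hS.pos.ne'
  have := Scheme.isProbabilityMeasure_uniformOn_draws hS hn
  simp_rw [psiBatch_eq hS.pos]
  rw [integral_const_mul, integral_finsetSum _ fun _ _ => Integrable.of_finite,
    Finset.sum_congr rfl fun l _ => integral_draw hS hn l (fun i => c + loss X y i θ),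
    add_risk_eq hn]
  simp only [Finset.sum_const, Finset.card_univ, Fintype.card_fin, nsmul_eq_mul]
  field_simp

lemma integral_psiBatch_sq {scheme : Scheme} (hn : 0 < n) (hS : scheme.Admissible n S) (c : ℝ)
    (θ : EuclideanSpace ℝ (Fin p)) :
    ∫ v, (psiBatch X y c v θ) ^ 2 ∂(uniformOn (scheme.draws n S)) = KG X y c S θ scheme := by
  have hS0 : (S : ℝ) ≠ 0 := by exact_mod_cast hS.pos.ne'
  have hn0 : (n : ℝ) ≠ 0 := by exact_mod_cast hn.ne'
  have := Scheme.isProbabilityMeasure_uniformOn_draws hS hn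
  set h := fun i => c + loss X y i θ with hh
  have hd : ∀ l, ∫ v, h (v l) * h (v l) ∂(uniformOn (scheme.draws n S))
      = (1 / (n : ℝ)) * ∑ i, h i ^ 2 := fun l => by
    rw [integral_draw hS hn l (fun i => h i * h i)]
    simp only [sq]
  simp_rw [psiBatch_eq hS.pos, mul_pow, sq (∑ l, _)]
  rw [integral_const_mul]
  cases scheme with
  | withReplacement =>
    rw [integral_sum_mul_sum h h hd fun l l' hl =>
      integral_draw_mul_draw_withReplacement hn hl h h, KG, add_risk_eq hn]
    field_simp
    rfl
  | withoutReplacement =>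
    rw [integral_sum_mul_sum h h hd fun l l' hl =>
      integral_draw_mul_draw_withoutReplacement hS.2 hl h h, KG, add_risk_eq hn]
    by_cases hS1 : S = 1
    · subst hS1
      simp
      exact Or.inl rfl
    · have hn1 : (n : ℝ) - 1 ≠ 0 := by
        have h1 : 1 < n := by
          have := hS.1
          have := hS.2
          omega
        have : (1 : ℝ) < n := by exact_mod_cast h1
        linarith
      simp only [← sq]
      rw [← hh]
      field_simp
      ring

lemma integral_upsBatch (hn : 0 < n) (hS : 0 < S) (θ : EuclideanSpace ℝ (Fin p)) :
    ∫ w, upsBatch X y w θ ∂(uniformOn (Scheme.withReplacement.draws n S))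
      = gradient (risk X y) θ := by
  have hadm : Scheme.withReplacement.Admissible n S := hS
  have : (S : ℝ) ≠ 0 := by exact_mod_cast hS.ne'
  have := Scheme.isProbabilityMeasure_uniformOn_draws hadm hn
  refine ext_inner_left ℝ fun u => ?_
  rw [← integral_inner Integrable.of_finite]
  simp_rw [upsBatch, gradient_risk, inner_smul_right, inner_sum]
  rw [integral_const_mul, integral_finsetSum _ fun _ _ => Integrable.of_finite,
    Finset.sum_congr rfl fun l _ =>
      integral_draw hadm hn l (fun i => inner ℝ u (gradient (loss X y i) θ))]
  simp only [Finset.sum_const, Finset.card_univ, Fintype.card_fin, nsmul_eq_mul]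
  field_simp

/-- At a critical point of the risk the batch gradient is centred, so only the diagonal terms of
its covariance remain. -/
lemma integral_inner_upsBatch_mul_inner (hn : 0 < n) (hS : 0 < S)
    {θ : EuclideanSpace ℝ (Fin p)} (hθ : gradient (risk X y) θ = 0)
    (u u' : EuclideanSpace ℝ (Fin p)) :
    ∫ w, inner ℝ u (upsBatch X y w θ) * inner ℝ u' (upsBatch X y w θ)
        ∂(uniformOn (Scheme.withReplacement.draws n S))
      = (1 / (S : ℝ)) * ((1 / (n : ℝ)) * ∑ i,
          inner ℝ u (gradient (loss X y i) θ) * inner ℝ u' (gradient (loss X y i) θ)) := by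
  have hadm : Scheme.withReplacement.Admissible n S := hS
  have hS0 : (S : ℝ) ≠ 0 := by exact_mod_cast hS.ne'
  have := Scheme.isProbabilityMeasure_uniformOn_draws hadm hn
  have hzero : ∀ u, (1 / (n : ℝ)) * ∑ i, inner ℝ u (gradient (loss X y i) θ) = 0 := fun u => by
    rw [← inner_sum, ← inner_smul_right, ← gradient_risk, hθ, inner_zero_right]
  simp_rw [upsBatch, inner_smul_right, inner_sum, mul_mul_mul_comm (1 / (S : ℝ))]
  rw [integral_const_mul, integral_sum_mul_sum (fun i => inner ℝ u (gradient (loss X y i) θ))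
    (fun i => inner ℝ u' (gradient (loss X y i) θ))
    (fun l => integral_draw hadm hn l (fun i => inner ℝ u (gradient (loss X y i) θ)
      * inner ℝ u' (gradient (loss X y i) θ)))
    (fun l l' hl => integral_draw_mul_draw_withReplacement hn hl
      (fun i => inner ℝ u (gradient (loss X y i) θ))
      (fun i => inner ℝ u' (gradient (loss X y i) θ))), hzero]
  field_simp
  ring

end Batch

/-! ### The stochastic gradient as a noisy vector field -/

lemma norm_average_le {V : Type*} [NormedAddCommGroup V] [NormedSpace ℝ V] {S : ℕ} (hS : 0 < S)
    {a : Fin S → V} {C : ℝ} (h : ∀ l, ‖a l‖ ≤ C) : ‖(1 / (S : ℝ)) • ∑ l, a l‖ ≤ C := by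
  have hS0 : (0 : ℝ) < S := by exact_mod_cast hS
  rw [norm_smul, Real.norm_eq_abs, abs_of_pos (by positivity), one_div, inv_mul_le_iff₀ hS0]
  refine (norm_sum_le _ _).trans ((Finset.sum_le_card_nsmul _ _ _ fun l _ => h l).trans_eq ?_)
  simp

lemma abs_average_le {S : ℕ} (hS : 0 < S) {a : Fin S → ℝ} {C : ℝ} (h : ∀ l, |a l| ≤ C) :
    |(1 / (S : ℝ)) * ∑ l, a l| ≤ C :=
  norm_average_le (V := ℝ) hS h

/-- The global lower bound for the drift. A convex function `k ≥ 0` with a nondegenerate critical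
point grows at least linearly, hence so does `⟪x, ∇k⟫`, and the product of `c + k` with `∇k`
points outwards at a linear rate even though `∇k` itself may stay bounded. -/
lemma exists_drift {E : Type*} [NormedAddCommGroup E] [InnerProductSpace ℝ E] {k : E → ℝ}
    {G : E → E} {T : E →L[ℝ] E} {c lam Q : ℝ} {θ : E} (hc : 0 < c) (hlam : 0 < lam) (hQ : 0 ≤ Q)
    (hk : ∀ u, 0 ≤ k u) (htan : ∀ u v, k u + inner ℝ (G u) (v - u) ≤ k v)
    (hT : ∀ x, lam * ‖x‖ ^ 2 ≤ inner ℝ x (T x))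
    (hG : ∀ x, ‖G (θ + x) - T x‖ ≤ Q * ‖x‖ ^ 2) :
    ∃ μ, 0 < μ ∧ ∀ x, μ * ‖x‖ ^ 2 ≤ inner ℝ x ((c + k (θ + x)) • G (θ + x)) := by
  -- within distance `r` of the critical point the quadratic term dominates
  set r := lam / (2 * (Q + 1)) with hr
  have hr0 : 0 < r := by positivity
  have hQr : Q * r ≤ lam / 2 := by
    rw [hr, mul_div_assoc', div_le_div_iff₀ (by positivity) (by positivity)]
    nlinarith
  have hnear : ∀ x, ‖x‖ ≤ r → lam / 2 * ‖x‖ ^ 2 ≤ inner ℝ x (G (θ + x)) := by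
    intro x hx
    have h1 : inner ℝ x (G (θ + x)) = inner ℝ x (T x) + inner ℝ x (G (θ + x) - T x) := by
      rw [← inner_add_right, add_sub_cancel]
    have h2 : |inner ℝ x (G (θ + x) - T x)| ≤ lam / 2 * ‖x‖ ^ 2 := by
      calc |inner ℝ x (G (θ + x) - T x)| ≤ ‖x‖ * ‖G (θ + x) - T x‖ := abs_real_inner_le_norm _ _
        _ ≤ r * (Q * ‖x‖ ^ 2) := by
          gcongr
          exact hG x
        _ = Q * r * ‖x‖ ^ 2 := by ring
        _ ≤ _ := by gcongr
    have h3 := (abs_le.1 h2).1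
    linarith [hT x]
  have hmono : ∀ u v, 0 ≤ inner ℝ (G v - G u) (v - u) := by
    intro u v
    have h1 := htan u v
    have h2 := htan v u
    rw [← neg_sub v u, inner_neg_right] at h2
    rw [inner_sub_left]
    linarith
  refine ⟨min (c * lam / 4) (lam ^ 2 * r ^ 2 / 8), by positivity, fun x => ?_⟩
  set μ := min (c * lam / 4) (lam ^ 2 * r ^ 2 / 8) with hμ
  rw [inner_smul_right]
  have hck : 0 < c + k (θ + x) := by linarith [hk (θ + x)]
  by_cases hx : ‖x‖ ≤ r
  · have h1 : c * (lam / 2 * ‖x‖ ^ 2) ≤ (c + k (θ + x)) * inner ℝ x (G (θ + x)) := by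
      refine mul_le_mul (by linarith [hk (θ + x)]) (hnear x hx) (by positivity) hck.le
    have h2 : μ * ‖x‖ ^ 2 ≤ c * lam / 4 * ‖x‖ ^ 2 := by
      gcongr
      exact min_le_left _ _
    have h3 : 0 ≤ c * lam * ‖x‖ ^ 2 := by positivity
    linarith
  · push Not at hx
    have hx0 : 0 < ‖x‖ := hr0.trans hx
    -- `x'` is the point of norm `r` on the ray through `x`
    set s := r / ‖x‖ with hs
    have hs0 : 0 < s := by positivity
    have hs1 : s < 1 := (div_lt_one hx0).2 hx
    set x' := s • x with hx'
    have hx'n : ‖x'‖ = r := by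
      rw [hx', norm_smul, Real.norm_eq_abs, abs_of_pos hs0, hs]
      field_simp
    have h1 := hnear x' hx'n.le
    rw [hx'n] at h1
    have hsub : θ + x - (θ + x') = (1 - s) • x := by
      rw [hx']
      module
    have h2 : inner ℝ x (G (θ + x')) ≤ inner ℝ x (G (θ + x)) := by
      have h3 := hmono (θ + x') (θ + x)
      rw [hsub, inner_smul_right, inner_sub_left] at h3
      have h4 := nonneg_of_mul_nonneg_right h3 (by linarith)
      rw [real_inner_comm, real_inner_comm x (G (θ + x'))] at h4
      linarith
    have h3 : lam / 2 * r * ‖x‖ ≤ inner ℝ x (G (θ + x')) := by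
      have e : ∀ v, inner ℝ x' v = s * inner ℝ x v := fun v => by
        rw [hx', inner_smul_left, conj_trivial]
      have hsr : ‖x‖ * s = r := by
        rw [hs]
        field_simp
      rw [e] at h1
      have h4 := mul_le_mul_of_nonneg_left h1 hx0.le
      rw [← mul_assoc ‖x‖ s, hsr] at h4
      refine le_of_mul_le_mul_left ?_ hr0
      linarith
    have hgrow : lam / 2 * r * (‖x‖ - r) ≤ k (θ + x) := by
      have h4 := htan (θ + x') (θ + x)
      rw [hsub, inner_smul_right, real_inner_comm] at h4
      have h5 : (1 - s) * (lam / 2 * r * ‖x‖) ≤ (1 - s) * inner ℝ x (G (θ + x')) :=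
        mul_le_mul_of_nonneg_left h3 (by linarith)
      have h6 : (1 - s) * ‖x‖ = ‖x‖ - r := by
        rw [hs]
        field_simp
      have h7 : (1 - s) * (lam / 2 * r * ‖x‖) = lam / 2 * r * (‖x‖ - r) := by
        rw [← h6]
        ring
      linarith [hk (θ + x')]
    have hin := h3.trans h2
    have hin0 : 0 ≤ lam / 2 * r * ‖x‖ := by positivity
    by_cases hx2 : ‖x‖ ≤ 2 * r
    · have h4 : c * (lam / 2 * r * ‖x‖) ≤ (c + k (θ + x)) * inner ℝ x (G (θ + x)) :=
        mul_le_mul (by linarith [hk (θ + x)]) hin hin0 hck.le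
      have h5 : μ * ‖x‖ ^ 2 ≤ c * lam / 4 * ‖x‖ ^ 2 := by
        gcongr
        exact min_le_left _ _
      have h6 : c * lam / 4 * ‖x‖ * ‖x‖ ≤ c * lam / 4 * ‖x‖ * (2 * r) := by gcongr
      linarith
    · push Not at hx2
      have h4 : lam / 4 * r * ‖x‖ ≤ c + k (θ + x) := by
        have : lam / 4 * r * (2 * r) ≤ lam / 4 * r * ‖x‖ := by gcongr
        linarith
      have h5 : lam / 4 * r * ‖x‖ * (lam / 2 * r * ‖x‖)
          ≤ (c + k (θ + x)) * inner ℝ x (G (θ + x)) := mul_le_mul h4 hin hin0 hck.le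
      have h6 : μ * ‖x‖ ^ 2 ≤ lam ^ 2 * r ^ 2 / 8 * ‖x‖ ^ 2 := by
        gcongr
        exact min_le_right _ _
      linarith

lemma exists_pos_mul_norm_sq_le_inner {E : Type*} [NormedAddCommGroup E] [InnerProductSpace ℝ E]
    [FiniteDimensional ℝ E] (T : E →L[ℝ] E) (hT : ∀ x, x ≠ 0 → 0 < inner ℝ x (T x)) :
    ∃ lam : ℝ, 0 < lam ∧ ∀ x, lam * ‖x‖ ^ 2 ≤ inner ℝ x (T x) := by
  have : ProperSpace E := FiniteDimensional.proper_real E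
  rcases subsingleton_or_nontrivial E with hE | hE
  · exact ⟨1, one_pos, fun x => by simp [Subsingleton.elim x 0]⟩
  obtain ⟨x₀, hx₀, hmin⟩ := (isCompact_sphere (0 : E) 1).exists_isMinOn
    (NormedSpace.sphere_nonempty.2 zero_le_one)
    (f := fun x => inner ℝ x (T x)) (by fun_prop)
  have hx₀0 : x₀ ≠ 0 := ne_zero_of_mem_unit_sphere ⟨x₀, hx₀⟩
  refine ⟨_, hT x₀ hx₀0, fun x => ?_⟩
  rcases eq_or_ne x 0 with rfl | hx
  · simp
  have hn : 0 < ‖x‖ := norm_pos_iff.2 hx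
  have h1 := hmin (show ‖x‖⁻¹ • x ∈ Metric.sphere (0 : E) 1 by
    simp [norm_smul, hn.ne'])
  simp only [Set.mem_ofPred_eq, map_smul, inner_smul_left, inner_smul_right, conj_trivial] at h1
  calc inner ℝ x₀ (T x₀) * ‖x‖ ^ 2 ≤ ‖x‖⁻¹ * (‖x‖⁻¹ * inner ℝ x (T x)) * ‖x‖ ^ 2 := by gcongr
    _ = _ := by field_simp

section Field

variable {n p : ℕ} {X : Fin n → EuclideanSpace ℝ (Fin p)} {y : Fin n → ℝ}

lemma risk_nonneg (θ : EuclideanSpace ℝ (Fin p)) : 0 ≤ risk X y θ :=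
  mul_nonneg (by positivity) (Finset.sum_nonneg fun i _ => loss_nonneg i θ)

lemma risk_tangent_le (θ θ' : EuclideanSpace ℝ (Fin p)) :
    risk X y θ + inner ℝ (gradient (risk X y) θ) (θ' - θ) ≤ risk X y θ' := by
  rw [gradient_risk, inner_smul_left, sum_inner, conj_trivial, risk, risk, ← mul_add,
    ← Finset.sum_add_distrib]
  exact mul_le_mul_of_nonneg_left (Finset.sum_le_sum fun i _ => loss_tangent_le i θ θ')
    (by positivity)

lemma norm_gradient_risk_taylor_le (hn : 0 < n) (hy : ∀ i, |y i| = 1)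
    {θ : EuclideanSpace ℝ (Fin p)} (hθ : gradient (risk X y) θ = 0)
    (x : EuclideanSpace ℝ (Fin p)) :
    ‖gradient (risk X y) (θ + x) - riskHess X y θ x‖ ≤ sampleBound X ^ 3 * ‖x‖ ^ 2 := by
  have h : gradient (risk X y) (θ + x) - riskHess X y θ x = (1 / (n : ℝ)) • ∑ i,
      (gradient (loss X y i) (θ + x) - gradient (loss X y i) θ - lossHess X y i θ x) := by
    rw [← sub_zero (gradient (risk X y) (θ + x)), ← hθ, gradient_risk, gradient_risk, riskHess]
    simp only [smul_apply, sum_apply, Finset.sum_sub_distrib, smul_sub]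
  rw [h]
  exact norm_average_le hn fun i => norm_gradient_loss_taylor_le (hy i) θ x

lemma norm_gradient_risk_le (hn : 0 < n) (hy : ∀ i, |y i| = 1)
    {θ : EuclideanSpace ℝ (Fin p)} (hθ : gradient (risk X y) θ = 0)
    (x : EuclideanSpace ℝ (Fin p)) :
    ‖gradient (risk X y) (θ + x)‖ ≤ sampleBound X ^ 2 * ‖x‖ := by
  have h : gradient (risk X y) (θ + x) = (1 / (n : ℝ)) • ∑ i,
      (gradient (loss X y i) (θ + x) - gradient (loss X y i) θ) := by
    rw [← sub_zero (gradient (risk X y) (θ + x)), ← hθ, gradient_risk, gradient_risk]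
    simp only [Finset.sum_sub_distrib, smul_sub]
  rw [h]
  exact norm_average_le hn fun i => norm_gradient_loss_sub_le (hy i) θ x

lemma abs_risk_sub_le (hn : 0 < n) (hy : ∀ i, |y i| = 1) (θ x : EuclideanSpace ℝ (Fin p)) :
    |risk X y (θ + x) - risk X y θ| ≤ sampleBound X * ‖x‖ := by
  rw [risk, risk, ← mul_sub, ← Finset.sum_sub_distrib]
  exact abs_average_le hn fun i => abs_loss_sub_le (hy i) θ x

/-- A bound at `θ` for all the values `c + kᵢ`. -/
noncomputable def levelBound (X : Fin n → EuclideanSpace ℝ (Fin p)) (y : Fin n → ℝ) (c : ℝ)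
    (θ : EuclideanSpace ℝ (Fin p)) : ℝ :=
  c + ∑ i, loss X y i θ

variable {c : ℝ} {θ : EuclideanSpace ℝ (Fin p)}

lemma levelBound_nonneg (hc : 0 ≤ c) : 0 ≤ levelBound X y c θ :=
  add_nonneg hc (Finset.sum_nonneg fun i _ => loss_nonneg i θ)

lemma abs_psiBatch_le {S : ℕ} (hS : 0 < S) (hc : 0 ≤ c) (v : Fin S → Fin n) :
    |psiBatch X y c v θ| ≤ levelBound X y c θ := by
  rw [psiBatch_eq hS]
  refine abs_average_le hS fun l => ?_
  have h0 := fun i => loss_nonneg (X := X) (y := y) i θ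
  rw [abs_of_nonneg (by linarith [h0 (v l)]), levelBound]
  gcongr
  exact Finset.single_le_sum (f := fun i => loss X y i θ) (fun i _ => h0 i)
    (Finset.mem_univ (v l))

lemma abs_psiBatch_sub_le {S : ℕ} (hS : 0 < S) (hy : ∀ i, |y i| = 1) (v : Fin S → Fin n)
    (x : EuclideanSpace ℝ (Fin p)) :
    |psiBatch X y c v (θ + x) - psiBatch X y c v θ| ≤ sampleBound X * ‖x‖ := by
  rw [psiBatch, psiBatch, add_sub_add_left_eq_sub, ← mul_sub, ← Finset.sum_sub_distrib]
  exact abs_average_le hS fun l => abs_loss_sub_le (hy _) θ x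

lemma norm_upsBatch_le {S : ℕ} (hS : 0 < S) (hy : ∀ i, |y i| = 1) (w : Fin S → Fin n)
    (θ : EuclideanSpace ℝ (Fin p)) : ‖upsBatch X y w θ‖ ≤ sampleBound X :=
  norm_average_le hS fun _ => norm_gradient_loss_le (hy _) θ

lemma norm_upsBatch_sub_le {S : ℕ} (hS : 0 < S) (hy : ∀ i, |y i| = 1) (w : Fin S → Fin n)
    (x : EuclideanSpace ℝ (Fin p)) :
    ‖upsBatch X y w (θ + x) - upsBatch X y w θ‖ ≤ sampleBound X ^ 2 * ‖x‖ := by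
  rw [upsBatch, upsBatch, ← smul_sub, ← Finset.sum_sub_distrib]
  exact norm_average_le hS fun l => norm_gradient_loss_sub_le (hy _) θ x

/-- The distribution of the pair of batches used in one step. -/
noncomputable def batchLaw (scheme : Scheme) (n SΨ SΥ : ℕ) :
    Measure ((Fin SΨ → Fin n) × (Fin SΥ → Fin n)) :=
  (uniformOn (scheme.draws n SΨ)).prod (uniformOn (Scheme.withReplacement.draws n SΥ))

/-- The stochastic gradient, as a random vector field in the displacement from `θ`. -/
noncomputable def gradField (X : Fin n → EuclideanSpace ℝ (Fin p)) (y : Fin n → ℝ) (c : ℝ)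
    (θ : EuclideanSpace ℝ (Fin p)) {SΨ SΥ : ℕ} (z : (Fin SΨ → Fin n) × (Fin SΥ → Fin n))
    (x : EuclideanSpace ℝ (Fin p)) : EuclideanSpace ℝ (Fin p) :=
  stochGrad X y c z.1 z.2 (θ + x)

variable {scheme : Scheme} {SΨ SΥ : ℕ}

lemma isProbabilityMeasure_batchLaw (hn : 0 < n) (hΨ : scheme.Admissible n SΨ) (hΥ : 1 ≤ SΥ) :
    IsProbabilityMeasure (batchLaw scheme n SΨ SΥ) := by
  have := Scheme.isProbabilityMeasure_uniformOn_draws hΨ hn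
  have : IsProbabilityMeasure (uniformOn (Scheme.withReplacement.draws n SΥ)) :=
    Scheme.isProbabilityMeasure_uniformOn_draws hΥ hn
  unfold batchLaw
  infer_instance

/-- The stochastic gradient is unbiased: its mean is the gradient of the objective. -/
lemma integral_gradField (hn : 0 < n) (hΨ : scheme.Admissible n SΨ) (hΥ : 1 ≤ SΥ)
    (x : EuclideanSpace ℝ (Fin p)) :
    ∫ z, gradField X y c θ z x ∂(batchLaw scheme n SΨ SΥ)
      = (c + risk X y (θ + x)) • gradient (risk X y) (θ + x) := by
  simp only [gradField, stochGrad, batchLaw]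
  rw [integral_prod_smul (fun v => psiBatch X y c v (θ + x)) (fun w => upsBatch X y w (θ + x)),
    integral_psiBatch hn hΨ, integral_upsBatch hn hΥ]

lemma norm_gradField_sub_le (hc : 0 ≤ c) (hy : ∀ i, |y i| = 1) (hΨ : 0 < SΨ) (hΥ : 0 < SΥ)
    (z : (Fin SΨ → Fin n) × (Fin SΥ → Fin n)) (x : EuclideanSpace ℝ (Fin p)) :
    ‖gradField X y c θ z x - gradField X y c θ z 0‖
      ≤ (sampleBound X ^ 2 + levelBound X y c θ * sampleBound X ^ 2) * ‖x‖ := by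
  have h : gradField X y c θ z x - gradField X y c θ z 0
      = (psiBatch X y c z.1 (θ + x) - psiBatch X y c z.1 θ) • upsBatch X y z.2 (θ + x)
        + psiBatch X y c z.1 θ • (upsBatch X y z.2 (θ + x) - upsBatch X y z.2 θ) := by
    simp only [gradField, stochGrad, add_zero]
    module
  have hB := sampleBound_nonneg (X := X)
  have hA := levelBound_nonneg (X := X) (y := y) (θ := θ) hc
  rw [h]
  refine (norm_add_le _ _).trans ?_
  rw [norm_smul, norm_smul, Real.norm_eq_abs, Real.norm_eq_abs]
  have h1 := mul_le_mul (abs_psiBatch_sub_le (c := c) (θ := θ) hΨ hy z.1 x)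
    (norm_upsBatch_le (X := X) hΥ hy z.2 (θ + x)) (norm_nonneg _) (by positivity)
  have h2 := mul_le_mul (abs_psiBatch_le (X := X) (y := y) (θ := θ) hΨ hc z.1)
    (norm_upsBatch_sub_le (X := X) (θ := θ) hΥ hy z.2 x) (norm_nonneg _) hA
  linarith

/-- The error of the linearisation `∇f (θ + x) ≈ (c + k θ) • ∇²k(θ) x` at a critical point. -/
lemma norm_gradient_objective_sub_le (hn : 0 < n) (hc : 0 ≤ c) (hy : ∀ i, |y i| = 1)
    (hθ : gradient (risk X y) θ = 0) (x : EuclideanSpace ℝ (Fin p)) :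
    ‖(c + risk X y (θ + x)) • gradient (risk X y) (θ + x) - ((c + risk X y θ) • riskHess X y θ) x‖
      ≤ (sampleBound X ^ 3 + (c + risk X y θ) * sampleBound X ^ 3) * ‖x‖ ^ 2 := by
  have h : (c + risk X y (θ + x)) • gradient (risk X y) (θ + x)
        - ((c + risk X y θ) • riskHess X y θ) x
      = (risk X y (θ + x) - risk X y θ) • gradient (risk X y) (θ + x)
        + (c + risk X y θ) • (gradient (risk X y) (θ + x) - riskHess X y θ x) := by
    simp only [smul_apply]
    module
  have hB := sampleBound_nonneg (X := X)
  have hk : 0 ≤ c + risk X y θ := add_nonneg hc (risk_nonneg θ)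
  rw [h]
  refine (norm_add_le _ _).trans ?_
  rw [norm_smul, norm_smul, Real.norm_eq_abs, Real.norm_eq_abs, abs_of_nonneg hk]
  have h1 := mul_le_mul (abs_risk_sub_le (X := X) hn hy θ x)
    (norm_gradient_risk_le (X := X) hn hy hθ x) (norm_nonneg _) (by positivity)
  have h2 := mul_le_mul_of_nonneg_left (norm_gradient_risk_taylor_le (X := X) hn hy hθ x) hk
  linarith

lemma noisyField_gradField {μ : ℝ} (hn : 0 < n) (hc : 0 ≤ c) (hy : ∀ i, |y i| = 1)
    (hθ : gradient (risk X y) θ = 0)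
    (hμ : ∀ x, μ * ‖x‖ ^ 2
      ≤ inner ℝ x ((c + risk X y (θ + x)) • gradient (risk X y) (θ + x)))
    (hΨ : scheme.Admissible n SΨ) (hΥ : 1 ≤ SΥ) :
    NoisyField (gradField X y c θ) (batchLaw scheme n SΨ SΥ)
      ((c + risk X y θ) • riskHess X y θ) (levelBound X y c θ * sampleBound X)
      (sampleBound X ^ 2 + levelBound X y c θ * sampleBound X ^ 2) μ
      (sampleBound X ^ 3 + (c + risk X y θ) * sampleBound X ^ 3) where
  continuous z := by
    have h1 := continuous_loss (X := X) (y := y)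
    have h2 := continuous_gradient_loss (X := X) (y := y)
    unfold gradField stochGrad psiBatch upsBatch
    fun_prop
  norm_zero_le z := by
    simp only [gradField, stochGrad, add_zero]
    rw [norm_smul]
    exact mul_le_mul (abs_psiBatch_le hΨ.pos hc _) (norm_upsBatch_le hΥ hy _ _) (norm_nonneg _)
      (levelBound_nonneg hc)
  norm_sub_zero_le := norm_gradField_sub_le hc hy hΨ.pos hΥ
  drift x := by
    rw [integral_gradField hn hΨ hΥ]
    exact hμ x
  linearisation x := by
    rw [integral_gradField hn hΨ hΥ]
    exact norm_gradient_objective_sub_le hn hc hy hθ x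

end Field

/-! ### Matrices as operators -/

section Operators

variable {n p : ℕ}

lemma opNorm_le_of_abs_inner_le {E : Type*} [NormedAddCommGroup E] [InnerProductSpace ℝ E]
    {W : E →L[ℝ] E} {C : ℝ} (hC : 0 ≤ C) (h : ∀ u v, |inner ℝ u (W v)| ≤ C * (‖u‖ * ‖v‖)) :
    ‖W‖ ≤ C := by
  refine W.opNorm_le_bound hC fun v => ?_
  have h1 := h (W v) v
  rw [real_inner_self_eq_norm_sq, abs_of_nonneg (by positivity)] at h1
  rcases (norm_nonneg (W v)).eq_or_lt with h0 | h0
  · rw [← h0]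
    positivity
  · refine le_of_mul_le_mul_left ?_ h0
    linarith

/-- The bilinear form `(x, x') ↦ ⟪u, x⟫ ⟪v, x'⟫`. -/
noncomputable def innerForm {E : Type*} [NormedAddCommGroup E] [InnerProductSpace ℝ E] (u v : E) :
    E →L[ℝ] E →L[ℝ] ℝ :=
  (innerSL ℝ u).smulRight (innerSL ℝ v)

lemma innerForm_apply {E : Type*} [NormedAddCommGroup E] [InnerProductSpace ℝ E] (u v x x' : E) :
    innerForm u v x x' = inner ℝ u x * inner ℝ v x' := rfl

lemma norm_innerForm {E : Type*} [NormedAddCommGroup E] [InnerProductSpace ℝ E] (u v : E) :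
    ‖innerForm u v‖ = ‖u‖ * ‖v‖ := by
  rw [innerForm, ContinuousLinearMap.norm_smulRight_apply]
  simp only [innerSL_apply_norm]

lemma inner_toEuclideanCLM_outer (a b u v : EuclideanSpace ℝ (Fin p)) :
    inner ℝ u (Matrix.toEuclideanCLM (n := Fin p) (𝕜 := ℝ) (outer a b) v)
      = inner ℝ u a * inner ℝ v b := by
  have h : outer a b = Matrix.vecMulVec a b := rfl
  rw [Matrix.inner_toEuclideanCLM, h, Matrix.vecMulVec_mulVec, dotProduct_smul]
  simp [EuclideanSpace.inner_eq_star_dotProduct, dotProduct_comm]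

lemma inner_toEuclideanCLM_secondMoment {Ω : Type*} [MeasurableSpace Ω] {P : Measure Ω}
    {Z : Ω → EuclideanSpace ℝ (Fin p)} {θ : EuclideanSpace ℝ (Fin p)}
    (hZ : MemLp (fun ω => Z ω - θ) 2 P) (u v : EuclideanSpace ℝ (Fin p)) :
    inner ℝ u (Matrix.toEuclideanCLM (n := Fin p) (𝕜 := ℝ) (secondMoment P Z θ) v)
      = ∫ ω, inner ℝ u (Z ω - θ) * inner ℝ v (Z ω - θ) ∂P := by
  have hint : ∀ i j, Integrable (fun ω => outer (Z ω - θ) (Z ω - θ) i j) P := fun i j => by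
    have hc : ∀ i, MemLp (fun ω => (Z ω - θ) i) 2 P := fun i =>
      (EuclideanSpace.proj (𝕜 := ℝ) i).comp_memLp' hZ
    exact (hc i).integrable_mul (hc j)
  have h1 : ∀ ω, inner ℝ u (Z ω - θ) * inner ℝ v (Z ω - θ)
      = ∑ i, ∑ j, u i * v j * outer (Z ω - θ) (Z ω - θ) i j := by
    intro ω
    rw [← inner_toEuclideanCLM_outer, Matrix.inner_toEuclideanCLM]
    simp only [dotProduct, Matrix.mulVec, Finset.mul_sum]
    exact Finset.sum_congr rfl fun i _ => Finset.sum_congr rfl fun j _ => by ring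
  simp_rw [h1]
  rw [integral_finsetSum _ fun i _ => integrable_finsetSum _ fun j _ => (hint i j).const_mul _,
    Matrix.inner_toEuclideanCLM]
  simp only [dotProduct, Matrix.mulVec, Finset.mul_sum]
  refine Finset.sum_congr rfl fun i _ => ?_
  rw [integral_finsetSum _ fun j _ => (hint i j).const_mul _]
  refine Finset.sum_congr rfl fun j _ => ?_
  rw [integral_const_mul, secondMoment, Matrix.of_apply]
  ring

variable {X : Fin n → EuclideanSpace ℝ (Fin p)} {y : Fin n → ℝ} {c : ℝ}
  {θ : EuclideanSpace ℝ (Fin p)} {scheme : Scheme} {SΨ SΥ : ℕ}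

/-- `G` is the covariance of the stochastic gradient at the minimizer. -/
lemma inner_toEuclideanCLM_GMat (hn : 0 < n) (hθ : gradient (risk X y) θ = 0)
    (hΨ : scheme.Admissible n SΨ) (hΥ : 1 ≤ SΥ) (u v : EuclideanSpace ℝ (Fin p)) :
    inner ℝ u (Matrix.toEuclideanCLM (n := Fin p) (𝕜 := ℝ) (GMat X y c scheme SΨ SΥ θ) v)
      = ∫ z, innerForm u v (gradField X y c θ z 0) (gradField X y c θ z 0)
          ∂(batchLaw scheme n SΨ SΥ) := by
  have h1 : ∀ z : (Fin SΨ → Fin n) × (Fin SΥ → Fin n),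
      innerForm u v (gradField X y c θ z 0) (gradField X y c θ z 0)
        = psiBatch X y c z.1 θ ^ 2
          * (inner ℝ u (upsBatch X y z.2 θ) * inner ℝ v (upsBatch X y z.2 θ)) := by
    intro z
    simp only [innerForm_apply, gradField, stochGrad, add_zero, inner_smul_right]
    ring
  simp_rw [h1, batchLaw]
  rw [integral_prod_mul (fun w => psiBatch X y c w θ ^ 2) (fun w =>
    inner ℝ u (upsBatch X y w θ) * inner ℝ v (upsBatch X y w θ)), integral_psiBatch_sq hn hΨ,
    integral_inner_upsBatch_mul_inner hn hΥ hθ]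
  simp only [GMat, map_smul, map_sum, smul_apply, sum_apply, inner_smul_right, inner_sum,
    inner_toEuclideanCLM_outer]
  ring

/-! ### Stochastic gradient descent as a chain -/

lemma IsSampling.isChain {Ω : Type*} [MeasurableSpace Ω] {P : Measure Ω} [IsProbabilityMeasure P]
    {θ₁ : Ω → EuclideanSpace ℝ (Fin p)} {v : ℕ → Ω → Fin SΨ → Fin n} {w : ℕ → Ω → Fin SΥ → Fin n}
    (h : IsSampling P scheme θ₁ v w) {η K : ℝ} (hK : ∀ᵐ ω ∂P, ‖θ₁ ω - θ‖ ^ 2 ≤ K) :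
    IsChain P (batchLaw scheme n SΨ SΥ) (gradField X y c θ) η
      (fun m ω => sgdIterate X y c η (θ₁ ω) (fun m => v m ω) (fun m => w m ω) m - θ)
      (fun m ω => (v m ω, w m ω)) where
  measurable_start := h.measurable_start.sub_const θ
  bounded_start := ⟨1 + K, hK.mono fun ω hω => by
    change ‖θ₁ ω - θ‖ ≤ 1 + K
    nlinarith [sq_nonneg (‖θ₁ ω - θ‖ - 1)]⟩
  measurable_innovation m := (h.measurable_psi m).prodMk (h.measurable_ups m)
  law m := by
    rw [(indepFun_iff_map_prod_eq_prod_map_map (h.measurable_psi m).aemeasurable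
      (h.measurable_ups m).aemeasurable).1 (h.indep_batches m), h.law_psi, h.law_ups, batchLaw]
  indep := h.indep_steps
  indep_start := h.indep_start.comp (φ := fun u => u - θ) (ψ := id) (by fun_prop) measurable_id
  step m ω := by
    simp only [sgdIterate, gradField, add_sub_cancel]
    abel

lemma sgdAverage_sub_eq {η : ℝ} {t : ℕ} (ht : 1 ≤ t) (θ₁ θ : EuclideanSpace ℝ (Fin p))
    (v : ℕ → Fin SΨ → Fin n) (w : ℕ → Fin SΥ → Fin n) :
    sgdAverage X y c η θ₁ v w t - θ
      = (t : ℝ)⁻¹ • ∑ m ∈ Finset.range t, (sgdIterate X y c η θ₁ v w m - θ) := by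
  have : (t : ℝ) ≠ 0 := by exact_mod_cast (by omega : t ≠ 0)
  rw [sgdAverage, Finset.sum_sub_distrib, smul_sub, one_div]
  simp only [Finset.sum_const, Finset.card_range]
  rw [← Nat.cast_smul_eq_nsmul ℝ, smul_smul, inv_mul_cancel₀ this, one_smul]

/-! ### Uniform constants and the spectral norm -/

/-- The step sizes for which the second and fourth moments contract. -/
lemma exists_stepsize {μ : ℝ} (hμ : 0 < μ) (L : ℝ) : ∃ η₀ : ℝ, 0 < η₀ ∧ ∀ η, 0 < η → η ≤ η₀ →
    η ≤ 1 ∧ 20 * η * L ^ 2 ≤ μ ∧ 16 * η * L ^ 4 ≤ μ ∧ 2 * (η * μ) ≤ 1 := by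
  refine ⟨min (min 1 (1 / (2 * μ))) (min (μ / (20 * L ^ 2 + 1)) (μ / (16 * L ^ 4 + 1))),
    by positivity, fun η hη h => ?_⟩
  obtain ⟨h12, h34⟩ := le_min_iff.1 h
  obtain ⟨h1, h2⟩ := le_min_iff.1 h12
  obtain ⟨h3, h4⟩ := le_min_iff.1 h34
  rw [le_div_iff₀ (by positivity)] at h2 h3 h4
  exact ⟨h1, by linarith, by linarith, by linarith⟩

/-- The second and fourth moments of the iterates for a start at distance of order `√η`. -/
lemma IsChain.moments_le {E F Ω : Type*} [NormedAddCommGroup E] [InnerProductSpace ℝ E]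
    [FiniteDimensional ℝ E] [MeasurableSpace E] [BorelSpace E] [Fintype F] [MeasurableSpace F]
    [MeasurableSingletonClass F] [MeasurableSpace Ω] {g : F → E → E} {ν : Measure F}
    [IsProbabilityMeasure ν] {A : E →L[ℝ] E} {D L μ Q η K R R₄ : ℝ} {P : Measure Ω}
    [IsProbabilityMeasure P] {x : ℕ → Ω → E} {Z : ℕ → Ω → F}
    (hx : IsChain P ν g η x Z) (hg : NoisyField g ν A D L μ Q) (hμ : 0 < μ) (hη : 0 < η)
    (hη1 : η ≤ 1) (hL : 20 * η * L ^ 2 ≤ μ) (hL4 : 16 * η * L ^ 4 ≤ μ) (hημ : 2 * (η * μ) ≤ 1)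
    (hR : R = |K| + 2 * D ^ 2 / μ) (hR₄ : R₄ = K ^ 2 + (10 * D ^ 2 * R + 8 * D ^ 4) / μ)
    (hK : ∀ᵐ ω ∂P, ‖x 0 ω‖ ^ 2 ≤ K * η) :
    (∀ m, ∫ ω, ‖x m ω‖ ^ 2 ∂P ≤ R * η) ∧ ∀ m, ∫ ω, ‖x m ω‖ ^ 4 ∂P ≤ R₄ * η ^ 2 := by
  have hKη : ∀ᵐ ω ∂P, ‖x 0 ω‖ ^ 2 ≤ |K| * η := hK.mono fun ω hω =>
    hω.trans (mul_le_mul_of_nonneg_right (le_abs_self K) hη.le)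
  have hR0 : 0 ≤ R := by
    rw [hR]
    positivity
  have hm2 : ∀ m, ∫ ω, ‖x m ω‖ ^ 2 ∂P ≤ R * η := by
    refine hx.integral_norm_sq_le hg hη.le (by nlinarith [sq_nonneg L]) (by linarith) ?_ ?_
    · rw [hR, mul_add, mul_div_cancel₀ _ hμ.ne']
      have : 0 ≤ μ * |K| := by positivity
      linarith
    · refine (integral_mono_ae (hx.integrable_comp hg (ψ := fun u => ‖u‖ ^ 2) (by fun_prop) 0)
        (integrable_const (|K| * η)) hKη).trans ?_
      simp only [integral_const, probReal_univ, one_smul]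
      have : 0 ≤ 2 * D ^ 2 / μ := by positivity
      gcongr
      linarith
  refine ⟨hm2, hx.integral_norm_pow_four_le hg hη.le hη1 hL hL4 hημ hm2 ?_ ?_⟩
  · rw [hR₄, mul_add, mul_div_cancel₀ _ hμ.ne']
    have : 0 ≤ μ * K ^ 2 := by positivity
    linarith
  · refine (integral_mono_ae (hx.integrable_comp hg (ψ := fun u => ‖u‖ ^ 4) (by fun_prop) 0)
      (integrable_const (K ^ 2 * η ^ 2)) (hKη.mono fun ω hω => ?_)).trans ?_
    · calc ‖x 0 ω‖ ^ 4 = (‖x 0 ω‖ ^ 2) ^ 2 := by ring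
        _ ≤ (|K| * η) ^ 2 := by gcongr
        _ = K ^ 2 * η ^ 2 := by rw [mul_pow, sq_abs]
    · simp only [integral_const, probReal_univ, one_smul]
      have : 0 ≤ (10 * D ^ 2 * R + 8 * D ^ 4) / μ := by positivity
      gcongr
      linarith

/-- Conjugation by `H⁻¹`: a bound for the bilinear forms of `H (Z - θ)` bounds the spectral norm of
the scaled second moment of `Z` minus `H⁻¹ G H⁻¹`. -/
lemma specNorm_smul_secondMoment_sub_le {Ω : Type*} [MeasurableSpace Ω] {P : Measure Ω}
    {H G : Matrix (Fin p) (Fin p) ℝ} (hH : H.PosDef)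
    {A : EuclideanSpace ℝ (Fin p) →L[ℝ] EuclideanSpace ℝ (Fin p)}
    (hA : Matrix.toEuclideanCLM (n := Fin p) (𝕜 := ℝ) H = A)
    {Z s : Ω → EuclideanSpace ℝ (Fin p)} {t : ℝ} (ht : t ≠ 0)
    (hs : ∀ ω, Z ω - θ = t⁻¹ • s ω) (hZ : MemLp (fun ω => Z ω - θ) 2 P) {C : ℝ} (hC : 0 ≤ C)
    (h : ∀ u u', |t⁻¹ * ∫ ω, innerForm u u' (A (s ω)) (A (s ω)) ∂P
      - inner ℝ u (Matrix.toEuclideanCLM (n := Fin p) (𝕜 := ℝ) G u')| ≤ ‖u‖ * ‖u'‖ * C) :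
    specNorm (t • secondMoment P Z θ - H⁻¹ * G * H⁻¹)
      ≤ ‖Matrix.toEuclideanCLM (n := Fin p) (𝕜 := ℝ) H⁻¹‖ ^ 2 * C := by
  set J := Matrix.toEuclideanCLM (n := Fin p) (𝕜 := ℝ) H⁻¹ with hJ
  have hJA : ∀ x, J (A x) = x := by
    intro x
    have h1 : J * A = 1 := by
      rw [hJ, ← hA, ← map_mul, Matrix.nonsing_inv_mul _ ((Matrix.isUnit_iff_isUnit_det _).1
        hH.isUnit), map_one]
    exact congrArg (fun T => T x) h1
  have hJsymm : ∀ u v, inner ℝ u (J v) = inner ℝ (J u) v := by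
    intro u v
    have h1 : star J = J := by
      rw [hJ, ← map_star]
      exact congrArg _ hH.isHermitian.inv
    rw [← ContinuousLinearMap.adjoint_inner_left, ← ContinuousLinearMap.star_eq_adjoint, h1]
  refine opNorm_le_of_abs_inner_le (by positivity) fun u u' => ?_
  have hinner : ∀ u x, inner ℝ u (t⁻¹ • x) = t⁻¹ * inner ℝ (J u) (A x) := by
    intro u x
    rw [← hJsymm, hJA, inner_smul_right]
  have hint : t * ∫ ω, t⁻¹ * inner ℝ (J u) (A (s ω)) * (t⁻¹ * inner ℝ (J u') (A (s ω))) ∂P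
      = t⁻¹ * ∫ ω, innerForm (J u) (J u') (A (s ω)) (A (s ω)) ∂P := by
    simp_rw [innerForm_apply, mul_mul_mul_comm t⁻¹]
    rw [integral_const_mul, ← mul_assoc]
    congr 1
    field_simp
  have hGJ : inner ℝ u ((J * Matrix.toEuclideanCLM (n := Fin p) (𝕜 := ℝ) G * J) u')
      = inner ℝ (J u) (Matrix.toEuclideanCLM (n := Fin p) (𝕜 := ℝ) G (J u')) :=
    hJsymm u _
  rw [map_sub, map_smul, map_mul, map_mul, sub_apply, smul_apply, inner_sub_right,
    inner_smul_right, inner_toEuclideanCLM_secondMoment hZ, ← hJ, hGJ]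
  simp_rw [hs, hinner]
  rw [hint]
  calc _ ≤ ‖J u‖ * ‖J u'‖ * C := h (J u) (J u')
    _ ≤ (‖J‖ * ‖u‖) * (‖J‖ * ‖u'‖) * C := by
        gcongr
        · exact J.le_opNorm u
        · exact J.le_opNorm u'
    _ = _ := by ring

/-- The constants in the bounds for the stochastic gradient do not depend on the batch sizes or on
the sampling scheme. -/
lemma exists_noisyField (hn : 0 < n) (hc : 0 < c) (hy : ∀ i, |y i| = 1)
    (hθ : gradient (risk X y) θ = 0) (hpos : (hessian (risk X y) θ).PosDef) :
    ∃ D L μ Q : ℝ, 0 ≤ D ∧ 0 ≤ L ∧ 0 < μ ∧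
      ∀ (scheme : Scheme) (SΨ SΥ : ℕ), scheme.Admissible n SΨ → 1 ≤ SΥ →
        NoisyField (gradField X y c θ) (batchLaw scheme n SΨ SΥ)
          ((c + risk X y θ) • riskHess X y θ) D L μ Q := by
  obtain ⟨lam, hlam, hlam'⟩ := exists_pos_mul_norm_sq_le_inner (riskHess X y θ) fun x hx => by
    rw [← toEuclideanCLM_hessian (hasFDerivAt_gradient_risk (X := X) (y := y) θ),
      Matrix.inner_toEuclideanCLM]
    have hx' : x.ofLp ≠ 0 := fun h => hx (WithLp.ofLp_injective 2 h)
    simpa using hpos.dotProduct_mulVec_pos hx'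
  have hB := sampleBound_nonneg (X := X)
  have hA := levelBound_nonneg (X := X) (y := y) (θ := θ) hc.le
  obtain ⟨μ, hμ, hdrift⟩ := exists_drift (k := risk X y) (G := gradient (risk X y)) hc hlam
    (pow_nonneg hB 3) risk_nonneg risk_tangent_le hlam'
    (norm_gradient_risk_taylor_le hn hy hθ)
  exact ⟨_, _, μ, _, by positivity, by positivity, hμ, fun scheme SΨ SΥ hΨ hΥ =>
    noisyField_gradField hn hc.le hy hθ hdrift hΨ hΥ⟩

end Operators

end LogisticSGD

theorem mainTheorem2 {n p : ℕ} (hn : 0 < n)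
    (X : Fin n → EuclideanSpace ℝ (Fin p)) (y : Fin n → ℝ) (hy : ∀ i, y i = 1 ∨ y i = -1)
    (c : ℝ) (hc : 0 < c)
    (θhat : EuclideanSpace ℝ (Fin p)) (hmin : IsMinOn (risk X y) Set.univ θhat)
    (hnondeg : (hessian (risk X y) θhat).PosDef) :
    hessian (objective X y c) θhat = (c + risk X y θhat) • hessian (risk X y) θhat ∧
    (∀ (scheme : Scheme) (S : ℕ), scheme.Admissible n S → ∀ θ : EuclideanSpace ℝ (Fin p),
      ∫ v, (psiBatch X y c v θ) ^ 2 ∂(uniformOn (scheme.draws n S)) = KG X y c S θ scheme) ∧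
    ∀ Smax : ℕ, ∃ η₀ : ℝ, 0 < η₀ ∧ ∀ K M : ℝ, ∃ C : ℝ, 0 < C ∧
      ∀ (scheme : Scheme) (SΨ SΥ : ℕ), scheme.Admissible n SΨ → 1 ≤ SΥ → SΨ ≤ Smax → SΥ ≤ Smax →
      ∀ (Ω : Type*) [MeasurableSpace Ω] (P : Measure Ω) [IsProbabilityMeasure P]
        (θ₁ : Ω → EuclideanSpace ℝ (Fin p))
        (v : ℕ → Ω → Fin SΨ → Fin n) (w : ℕ → Ω → Fin SΥ → Fin n),
      IsSampling P scheme θ₁ v w →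
      ∀ η : ℝ, 0 < η → η ≤ η₀ → (∀ᵐ ω ∂P, ‖θ₁ ω - θhat‖ ^ 2 ≤ K * η) →
      ∀ t : ℕ, 1 ≤ t → (t : ℝ) * η ^ 2 ≤ M →
        MemLp (fun ω => sgdAverage X y c η (θ₁ ω) (fun m => v m ω) (fun m => w m ω) t) 2 P ∧
        specNorm ((t : ℝ) • secondMoment P
            (fun ω => sgdAverage X y c η (θ₁ ω) (fun m => v m ω) (fun m => w m ω) t) θhat
          - (hessian (objective X y c) θhat)⁻¹ * GMat X y c scheme SΨ SΥ θhat *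
              (hessian (objective X y c) θhat)⁻¹)
          ≤ C * (√η + √(1 / ((t : ℝ) * η) + (t : ℝ) * η ^ 2)) := by
  have hy' : ∀ i, |y i| = 1 := fun i => by rcases hy i with h | h <;> simp [h]
  have hgrad := gradient_risk_eq_zero hmin
  have hck : 0 < c + risk X y θhat := by linarith [risk_nonneg (X := X) (y := y) θhat]
  have hobj := toEuclideanCLM_hessian (hasFDerivAt_gradient_objective c hgrad)
  have hH : hessian (objective X y c) θhat
      = (c + risk X y θhat) • hessian (risk X y) θhat := by
    refine EquivLike.injective (Matrix.toEuclideanCLM (n := Fin p) (𝕜 := ℝ)) ?_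
    rw [map_smul, hobj,
      toEuclideanCLM_hessian (hasFDerivAt_gradient_risk (X := X) (y := y) θhat)]
  refine ⟨hH, fun scheme S hS θ => integral_psiBatch_sq hn hS c θ, fun Smax => ?_⟩
  have hHpos : (hessian (objective X y c) θhat).PosDef := by
    rw [hH]
    exact hnondeg.smul hck
  obtain ⟨D, L, μ, Q, hD, hL, hμ, hfield⟩ := exists_noisyField (X := X) hn hc hy' hgrad hnondeg
  obtain ⟨η₀, hη₀, hstep⟩ := exists_stepsize hμ L
  refine ⟨η₀, hη₀, fun K M => ?_⟩
  -- `R` and `R₄` are the levels at which the moment recursions balance, raised to admit the start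
  obtain ⟨R, hR⟩ : ∃ R, R = |K| + 2 * D ^ 2 / μ := ⟨_, rfl⟩
  obtain ⟨R₄, hR₄⟩ : ∃ R₄, R₄ = K ^ 2 + (10 * D ^ 2 * R + 8 * D ^ 4) / μ := ⟨_, rfl⟩
  have hR0 : 0 ≤ R := by
    rw [hR]
    positivity
  have hR₄0 : 0 ≤ R₄ := by
    rw [hR₄]
    positivity
  generalize hA : (c + risk X y θhat) • riskHess X y θhat = A at hobj hfield
  obtain ⟨C, hC⟩ : ∃ C, C = (4 * L ^ 2 * R + 2 * D * L * (R + 1))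
    + (D ^ 2 + (4 * L ^ 2 * R + 2 * D * L * (R + 1)))
    + (8 * R + 2 * Q ^ 2 * R₄) * (1 + √(1 + M)) + (‖A‖ ^ 2 * R + D ^ 2) := ⟨_, rfl⟩
  have hC0 : 0 ≤ C := by
    rw [hC]
    positivity
  obtain ⟨j, hj⟩ : ∃ j, j = ‖Matrix.toEuclideanCLM (n := Fin p) (𝕜 := ℝ)
    (hessian (objective X y c) θhat)⁻¹‖ := ⟨_, rfl⟩
  refine ⟨j ^ 2 * C + 1, by positivity, ?_⟩
  intro scheme SΨ SΥ hΨ hΥ _ _ Ω _ P _ θ₁ v w hsamp η hη hηle hstart t ht htM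
  obtain ⟨hη1, hL2, hL4, hημ⟩ := hstep η hη hηle
  have := isProbabilityMeasure_batchLaw hn hΨ hΥ
  have hg := hfield scheme SΨ SΥ hΨ hΥ
  have hx := hsamp.isChain (X := X) (y := y) (c := c) (η := η) hstart
  obtain ⟨hm2, hm4⟩ := hx.moments_le hg hμ hη hη1 hL2 hL4 hημ hR hR₄ hstart
  have havg : ∀ ω, sgdAverage X y c η (θ₁ ω) (fun m => v m ω) (fun m => w m ω) t - θhat
      = (t : ℝ)⁻¹ • ∑ m ∈ Finset.range t,
        (sgdIterate X y c η (θ₁ ω) (fun m => v m ω) (fun m => w m ω) m - θhat) :=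
    fun ω => sgdAverage_sub_eq ht (θ₁ ω) θhat (fun m => v m ω) (fun m => w m ω)
  have hmem : MemLp (fun ω => sgdAverage X y c η (θ₁ ω) (fun m => v m ω) (fun m => w m ω) t
      - θhat) 2 P := by
    rw [funext havg]
    exact (hx.memLp_sum hg t).const_smul (t : ℝ)⁻¹
  refine ⟨by simpa [Pi.add_def] using hmem.add (memLp_const θhat), ?_⟩
  have hρ : 0 ≤ √η + √(1 / (t * η) + t * η ^ 2) := by positivity
  have ht0 : (t : ℝ) ≠ 0 := by exact_mod_cast (by omega : t ≠ 0)
  refine (specNorm_smul_secondMoment_sub_le (G := GMat X y c scheme SΨ SΥ θhat) hHpos hobj ht0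
    havg hmem (mul_nonneg hC0 hρ) fun u u' => ?_).trans ?_
  · have hkey := hx.abs_integral_bilin_sub_le hg hD hL hη hη1 hm2 hm4 (innerForm u u') ht htM
    rw [← hC, ← inner_toEuclideanCLM_GMat hn hgrad hΨ hΥ, norm_innerForm] at hkey
    exact hkey.trans_eq (mul_assoc _ _ _)
  · rw [← hj, ← mul_assoc]
    gcongr
    linarith
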